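/- **Setting.** An *abelian network* $N$ on a finite directed graph $G=(V,E)$ (loops and multiple edges allowed) assigns to each vertex $v$ an automaton with input alphabet $A_v$, nonempty state space $Q_v$, transition functions $T_a:Q_v\to Q_v$ ($a\in A_v$) and message-passing functions $T_e:Q_v\times A_v\to A_u^*$ for each edge $e=(v,u)$ (where $A_u^*$ is the set of finite words over $A_u$), such that for all $a,b\in A_v$ and $q\in Q_v$ one has $T_aT_b=T_bT_a$, and the words $T_e(q,a)\,T_e(T_a q,b)$ and $T_e(q,b)\,T_e(T_b q,a)$ agree up to permuting letters. Let $A=\bigsqcup_v A_v$, $Q=\prod_v Q_v$, and for a word $w$ let $|w|\in\mathbb N^A$ be its vector of letter counts. For $a\in A_v$ let $t_a:Q\to Q$ apply $T_a$ to the coordinate at $v$ and fix all other coordinates, and put $N_a(q)=\sum_{e}|T_e(q(v),a)|\in\mathbb N^A$, summed over the edges $e$ out of $v$. For a word $w=a_1\cdots a_\ell$ put $t_w=t_{a_\ell}\cdots t_{a_1}$ and $N_w(q)=\sum_i N_{a_i}(t_{a_{i-1}}\cdots t_{a_1}q)$; these depend only on $|w|$, so $t_n$ and $N_n$ are defined for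 $n\in\mathbb N^A$. The network is *finite* if all $A_v$ and $Q_v$ are finite, and *locally irreducible* if for all $q,q'\in Q$ there are words $w,w'$ with $t_wq=t_{w'}q'$. *Total kernel and production matrix.* Let $N$ be finite. A state is *locally recurrent* if it lies in $eQ$, where $e$ is the product of all idempotents of the monoid generated by the maps $t_a$. The *total kernel* $K\subseteq\mathbb Z^A$ is the subgroup of all $z$ with $t_{z^+}q=t_{z^-}q$ for every locally recurrent $q$. If $N$ is moreover locally irreducible, the *production matrix* $P$ is the unique rational $A\times A$ matrix with $Pk=N_k(q)$ for all $k\in K\cap\mathbb N^A$ and all locally recurrent $q$; here $(I-P)K\subseteq\mathbb Z^A$. *Trajectory digraph.* Configurations are pairs $x.q$ with $x\in\mathbb Z^A$, $q\in Q$. The trajectory digraph has an edge labelled $a$ from $x.q$ to $(x+N_a(q)-|a|).t_aq$ whenever $x(a)\ge1$. Its components are the classes of the equivalence relation "directed paths lead from the two configurations to a common configuration"; $\overline{x.q}$ is the component of $x.q$. A component is *recurrent* if it contains a forward, backward or bidirectional infinite walk in which every letter of $A$ occurs infinitely often as an edge label. Let $\mathcal L$ be the set of recurrent components. *Shift monoid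 and torsion group.* $\mathbb N^A$ acts on $\mathcal L$ by $\phi(n)\overline{x.q}=\overline{(x+n).q}$. The *shift monoid* is $\phi(\mathbb N^A)\subseteq\mathrm{End}(\mathcal L)$, $\mathcal G$ denotes its Grothendieck group, and the *torsion group* $\mathrm{Tor}(N)$ is the torsion subgroup of $\mathcal G$. Write $[m,m']$ for the class in $\mathcal G$ of a pair of elements of the shift monoid. A component $C\in\mathcal L$ is *invertible* if for every $g\in\mathrm{Tor}(N)$ and all $n,n'\in\mathbb N^A$ with $g=[\phi(n),\phi(n')]$ there is $C'\in\mathcal L$ with $\phi(n)C=\phi(n')C'$. Let $\mathcal L^\times$ be the set of invertible recurrent components. **Theorem.** Let $N$ be a finite, locally irreducible abelian network with nonempty total alphabet $A$. Then: 1. $\mathcal L^\times$ is nonempty. 2. $\mathrm{Tor}(N)$ is a finite abelian group, and there is a well-defined free action of $\mathrm{Tor}(N)$ on $\mathcal L^\times$ in which, for $g\in\mathrm{Tor}(N)$ and $C\in\mathcal L^\times$, the component $gC$ is, for every representation $g=[\phi(n),\phi(n')]$, the unique $C'\in\mathcal L$ with $\phi(n)C=\phi(n')C'$. 3. The map $\phi$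 induces an isomorphism of abelian groups $\mathcal G\cong\mathbb Z^A/(I-P)K$, which sends the class $[\phi(n),1]$ to the class of $n$ for every $n\in\mathbb N^A$. -/

import Mathlib

set_option linter.unusedSectionVars false
set_option linter.checkUnivs false

universe u v w x

noncomputable section

open scoped Classical

/-- An abelian network on a directed graph with vertex set `V`; loops and multiple edges are
allowed, and `u ⟶ v` is the type of edges from `u` to `v`. -/
structure AbelianNetwork (V : Type u) [Quiver.{v} V] where
  /-- The input alphabet of the processor at a vertex. -/
  Alph : V → Type w
  /-- The state space of the processor at a vertex. -/
  St : V → Type x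
  nonempty_St : ∀ v, Nonempty (St v)
  /-- The transition functions of the processors. -/
  next : ∀ v, Alph v → St v → St v
  /-- The message-passing functions: the word sent along an edge. -/
  msg : ∀ {v u : V}, (v ⟶ u) → St v → Alph v → List (Alph u)
  next_comm : ∀ v (a b : Alph v) (q : St v), next v a (next v b q) = next v b (next v a q)
  /-- The total message does not depend on the order of the letters, up to permutation. -/
  msg_comm : ∀ {v u : V} (e : v ⟶ u) (a b : Alph v) (q : St v),
    (msg e q a ++ msg e (next v a q) b).Perm (msg e q b ++ msg e (next v b q) a)

/-- The vector counting how often each letter occurs in a word. -/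
def wordVec {α : Type*} (w : List α) : α → ℕ := fun a => w.count a

theorem wordVec_append {α : Type*} (w w' : List α) :
    wordVec (w ++ w') = wordVec w + wordVec w' := by
  funext a
  simp [wordVec]

theorem wordVec_eq_iff_perm {α : Type*} {w w' : List α} : wordVec w = wordVec w' ↔ w.Perm w' := by
  rw [List.perm_iff_count]
  exact funext_iff

theorem wordVec_singleton_of_ne {α : Type*} {a b : α} (h : a ≠ b) : wordVec [a] b = 0 := by
  simp [wordVec, h]

theorem exists_wordVec {α : Type*} [Fintype α] (n : α → ℕ) : ∃ w : List α, wordVec w = n := by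
  refine ⟨(∑ a : α, Multiset.replicate (n a) a).toList, ?_⟩
  funext b
  simp only [wordVec]
  rw [← Multiset.coe_count, Multiset.coe_toList, Multiset.count_sum']
  simp [Multiset.count_replicate]

/-- The minimal idempotent of a finite commutative monoid: the product of all idempotents. -/
def minimalIdempotent (M : Type*) [CommMonoid M] : M :=
  ∏ᶠ f ∈ {f : M | f * f = f}, f

namespace AbelianNetwork

/-- The total alphabet, the disjoint union of the alphabets of the processors. -/
abbrev Letter {V : Type u} [Quiver.{v} V] (N : AbelianNetwork.{u, v, w, x} V) : Type (max u w) :=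
  Σ v : V, N.Alph v

/-- The total state space. -/
abbrev State {V : Type u} [Quiver.{v} V] (N : AbelianNetwork.{u, v, w, x} V) : Type (max u x) :=
  ∀ v : V, N.St v

/-- Configurations `x.q`, consisting of an input vector and a state. -/
abbrev Config {V : Type u} [Quiver.{v} V] (N : AbelianNetwork.{u, v, w, x} V) :
    Type (max u w x) :=
  (N.Letter → ℤ) × N.State

section Dynamics

variable {V : Type u} [Quiver.{v} V] (N : AbelianNetwork.{u, v, w, x} V)

/-- The total transition function of a letter. -/
def t (a : N.Letter) (q : N.State) : N.State :=
  Function.update q a.1 (N.next a.1 a.2 (q a.1))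

/-- The total transition function of a word (its first letter is processed first). -/
def tWord : List N.Letter → N.State → N.State
  | [], q => q
  | a :: w, q => tWord w (N.t a q)

/-- `N` is locally irreducible if any two states have a common successor. -/
def LocallyIrreducible : Prop :=
  ∀ q q' : N.State, ∃ w w' : List N.Letter, N.tWord w q = N.tWord w' q'

theorem t_comm (a b : N.Letter) (q : N.State) : N.t a (N.t b q) = N.t b (N.t a q) := by
  obtain ⟨v, a⟩ := a
  obtain ⟨v', b⟩ := b
  by_cases h : v = v'
  · subst h
    simp [t, N.next_comm v a b]
  · simp only [t]
    rw [Function.update_of_ne h, Function.update_of_ne (Ne.symm h), Function.update_comm h]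

theorem tWord_perm {w w' : List N.Letter} (h : w.Perm w') (q : N.State) :
    N.tWord w q = N.tWord w' q := by
  induction h generalizing q with
  | nil => rfl
  | cons a _ ih => exact ih _
  | swap a b l => simp only [tWord, N.t_comm]
  | trans _ _ ih1 ih2 => rw [ih1, ih2]

theorem tWord_append (w w' : List N.Letter) (q : N.State) :
    N.tWord (w ++ w') q = N.tWord w' (N.tWord w q) := by
  induction w generalizing q with
  | nil => rfl
  | cons a w ih => exact ih _

/-- The transition monoid, generated by the total transition functions of the letters inside the
monoid of self-maps of the state space. -/
def transitionMonoid : Submonoid (Function.End N.State) :=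
  Submonoid.closure (Set.range fun a => (N.t a : Function.End N.State))

instance instCommMonoidTransitionMonoid : CommMonoid N.transitionMonoid :=
  { (inferInstance : Monoid N.transitionMonoid) with
    mul_comm := (Submonoid.isMulCommutative_closure (Function.End N.State) (by
      rintro _ ⟨a, rfl⟩ _ ⟨b, rfl⟩
      funext q
      exact N.t_comm a b q)).is_comm.comm }

/-- The locally recurrent states: the image of the minimal idempotent of the transition monoid. -/
def Loc : Set N.State :=
  Set.range ((minimalIdempotent N.transitionMonoid : N.transitionMonoid) : Function.End N.State)

variable [Fintype V] [∀ u v : V, Fintype (u ⟶ v)]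

/-- The message-passing vector: how many letters of each kind are produced when the network in
state `q` processes the letter `a`. -/
def out (a : N.Letter) (q : N.State) : N.Letter → ℕ :=
  ∑ u : V, ∑ e : (a.1 ⟶ u), wordVec ((N.msg e (q a.1) a.2).map (Sigma.mk u))

/-- The message-passing vector of a word. -/
def outWord : List N.Letter → N.State → N.Letter → ℕ
  | [], _ => 0
  | a :: w, q => N.out a q + outWord w (N.t a q)

/-- The configuration transition function of a letter. -/
def confStep (a : N.Letter) (c : N.Config) : N.Config :=
  (fun b => c.1 b + (N.out a c.2 b : ℤ) - (wordVec [a] b : ℤ), N.t a c.2)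

/-- `c` and `c'` are joined by an edge labelled `a` in the trajectory digraph: processing the
letter `a` is legal at `c` and leads to `c'`. -/
def Edge (a : N.Letter) (c c' : N.Config) : Prop :=
  1 ≤ c.1 a ∧ N.confStep a c = c'

/-- There is a (finite, possibly empty) legal execution from one configuration to another. -/
def Reaches : N.Config → N.Config → Prop :=
  Relation.ReflTransGen fun c c' => ∃ a, N.Edge a c c'

/-- Two configurations are legally related if legal executions lead from them to a common
configuration. -/
def LegallyRelated (c₁ c₂ : N.Config) : Prop :=
  ∃ c₃, N.Reaches c₁ c₃ ∧ N.Reaches c₂ c₃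

theorem out_comm (a b : N.Letter) (q : N.State) :
    N.out a q + N.out b (N.t a q) = N.out b q + N.out a (N.t b q) := by
  obtain ⟨v, a⟩ := a
  obtain ⟨v', b⟩ := b
  by_cases h : v = v'
  · subst h
    simp only [out, t, Function.update_self, ← Finset.sum_add_distrib]
    refine Finset.sum_congr rfl fun u _ => Finset.sum_congr rfl fun e _ => ?_
    rw [← wordVec_append, ← wordVec_append, ← List.map_append, ← List.map_append,
      wordVec_eq_iff_perm]
    exact (N.msg_comm e a b (q v)).map (Sigma.mk u)
  · simp only [out, t]
    rw [Function.update_of_ne h, Function.update_of_ne (Ne.symm h), add_comm]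

theorem outWord_perm {w w' : List N.Letter} (h : w.Perm w') (q : N.State) :
    N.outWord w q = N.outWord w' q := by
  induction h generalizing q with
  | nil => rfl
  | cons a _ ih => simp only [outWord, ih]
  | swap a b l => simp only [outWord, ← add_assoc, N.out_comm a b, N.t_comm a b]
  | trans _ _ ih1 ih2 => rw [ih1, ih2]

theorem outWord_append (w w' : List N.Letter) (q : N.State) :
    N.outWord (w ++ w') q = N.outWord w q + N.outWord w' (N.tWord w q) := by
  induction w generalizing q with
  | nil => simp [outWord, tWord]
  | cons a w ih => simp only [List.cons_append, outWord, tWord, ih, add_assoc]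

theorem confStep_comm (a b : N.Letter) (c : N.Config) :
    N.confStep a (N.confStep b c) = N.confStep b (N.confStep a c) := by
  refine Prod.ext ?_ (N.t_comm a b c.2)
  funext d
  have := congrFun (N.out_comm a b c.2) d
  simp only [Pi.add_apply] at this
  simp only [confStep]
  zify at this
  linarith

theorem edge_confluent (c c₁ c₂ : N.Config) (h₁ : ∃ a, N.Edge a c c₁) (h₂ : ∃ a, N.Edge a c c₂) :
    ∃ d, Relation.ReflGen (fun c c' => ∃ a, N.Edge a c c') c₁ d ∧
      Relation.ReflTransGen (fun c c' => ∃ a, N.Edge a c c') c₂ d := by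
  obtain ⟨a, ha, rfl⟩ := h₁
  obtain ⟨b, hb, rfl⟩ := h₂
  by_cases hab : a = b
  · subst hab
    exact ⟨_, .refl, .refl⟩
  · have key : ∀ a b : N.Letter, a ≠ b → 1 ≤ c.1 b → 1 ≤ (N.confStep a c).1 b := by
      intro a b hab hb
      simp only [confStep, wordVec_singleton_of_ne hab]
      have := Int.natCast_nonneg (N.out a c.2 b)
      push_cast
      linarith
    exact ⟨N.confStep b (N.confStep a c), .single ⟨b, key a b hab hb, rfl⟩,
      .single ⟨a, key b a (Ne.symm hab) ha, N.confStep_comm a b c⟩⟩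

theorem legallyRelated_equivalence : Equivalence N.LegallyRelated :=
  Relation.equivalence_join_reflTransGen N.edge_confluent

/-- The setoid of the legal relation. -/
def legalSetoid : Setoid N.Config := ⟨N.LegallyRelated, N.legallyRelated_equivalence⟩

/-- The components of the trajectory digraph: the equivalence classes of the legal relation. -/
def Component : Type (max u w x) := Quotient N.legalSetoid

/-- The component of a configuration. -/
def component (c : N.Config) : N.Component := Quotient.mk N.legalSetoid c

/-- A component is recurrent if it contains a diverse infinite walk, i.e. an infinite legal
execution (forward, backward or bidirectional) in which every letter is processed infinitely
often. -/
def IsRecurrent (C : N.Component) : Prop :=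
  (∃ (c : ℕ → N.Config) (a : ℕ → N.Letter), (∀ i, N.Edge (a i) (c i) (c (i + 1))) ∧
    (∀ b, {i | a i = b}.Infinite) ∧ ∀ i, N.component (c i) = C) ∨
  (∃ (c : ℕ → N.Config) (a : ℕ → N.Letter), (∀ i, N.Edge (a i) (c (i + 1)) (c i)) ∧
    (∀ b, {i | a i = b}.Infinite) ∧ ∀ i, N.component (c i) = C) ∨
  (∃ (c : ℤ → N.Config) (a : ℤ → N.Letter), (∀ i, N.Edge (a i) (c i) (c (i + 1))) ∧
    (∀ b, {i | a i = b}.Infinite) ∧ ∀ i, N.component (c i) = C)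

/-- The set of recurrent components. -/
def Lrec : Type (max u w x) := {C : N.Component // N.IsRecurrent C}

/-- Adding an input vector to a configuration. -/
def addInput (n : N.Letter → ℕ) (c : N.Config) : N.Config := (fun a => c.1 a + (n a : ℤ), c.2)

theorem edge_addInput (n : N.Letter → ℕ) {a : N.Letter} {c c' : N.Config} (h : N.Edge a c c') :
    N.Edge a (N.addInput n c) (N.addInput n c') := by
  obtain ⟨h, rfl⟩ := h
  refine ⟨?_, Prod.ext ?_ rfl⟩
  · have := Int.natCast_nonneg (n a)
    simp only [addInput]
    linarith
  · funext b
    simp only [addInput, confStep]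
    ring

theorem reaches_addInput (n : N.Letter → ℕ) {c c' : N.Config} (h : N.Reaches c c') :
    N.Reaches (N.addInput n c) (N.addInput n c') :=
  Relation.ReflTransGen.lift (N.addInput n) (fun _ _ ⟨a, h⟩ => ⟨a, N.edge_addInput n h⟩) _ _ h

/-- The shift of components, sending the component of `x.q` to the component of `(x + n).q`. -/
def shiftComponent (n : N.Letter → ℕ) : N.Component → N.Component :=
  Quotient.map (sa := N.legalSetoid) (sb := N.legalSetoid) (N.addInput n) fun _ _ ⟨d, h₁, h₂⟩ =>
    ⟨N.addInput n d, N.reaches_addInput n h₁, N.reaches_addInput n h₂⟩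

theorem shiftComponent_component (n : N.Letter → ℕ) (c : N.Config) :
    N.shiftComponent n (N.component c) = N.component (N.addInput n c) := rfl

theorem isRecurrent_shift (n : N.Letter → ℕ) {C : N.Component} (h : N.IsRecurrent C) :
    N.IsRecurrent (N.shiftComponent n C) := by
  rcases h with ⟨c, a, h, hd, hc⟩ | ⟨c, a, h, hd, hc⟩ | ⟨c, a, h, hd, hc⟩
  · exact Or.inl ⟨fun i => N.addInput n (c i), a, fun i => N.edge_addInput n (h i), hd,
      fun i => by rw [← hc i, shiftComponent_component]⟩
  · exact Or.inr (Or.inl ⟨fun i => N.addInput n (c i), a, fun i => N.edge_addInput n (h i), hd,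
      fun i => by rw [← hc i, shiftComponent_component]⟩)
  · exact Or.inr (Or.inr ⟨fun i => N.addInput n (c i), a, fun i => N.edge_addInput n (h i), hd,
      fun i => by rw [← hc i, shiftComponent_component]⟩)

/-- The shift of recurrent components by an input vector. -/
def shift (n : N.Letter → ℕ) (C : N.Lrec) : N.Lrec :=
  ⟨N.shiftComponent n C.1, N.isRecurrent_shift n C.2⟩

/-- The action of `ℕ^A` on the set of recurrent components. -/
def phi : Multiplicative (N.Letter → ℕ) →* Function.End N.Lrec where
  toFun n := N.shift n.toAdd
  map_one' := by
    funext ⟨C, hC⟩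
    refine Subtype.ext ?_
    induction C using Quotient.inductionOn with
    | h c =>
      refine congrArg N.component (Prod.ext ?_ rfl)
      funext a
      simp [addInput]
  map_mul' m n := by
    funext ⟨C, hC⟩
    refine Subtype.ext ?_
    induction C using Quotient.inductionOn with
    | h c =>
      refine congrArg N.component (Prod.ext ?_ rfl)
      funext a
      simp only [addInput, toAdd_mul, Pi.add_apply]
      push_cast
      ring

/-- The shift monoid, the image of `ℕ^A` in the monoid of self-maps of the set of recurrent
components. -/
def ShiftMonoid : Submonoid (Function.End N.Lrec) := MonoidHom.mrange N.phi

instance instCommMonoidShiftMonoid : CommMonoid N.ShiftMonoid where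
  __ := (inferInstance : Monoid N.ShiftMonoid)
  mul_comm := by
    rintro ⟨_, m, rfl⟩ ⟨_, n, rfl⟩
    refine Subtype.ext ?_
    change N.phi m * N.phi n = N.phi n * N.phi m
    rw [← map_mul, ← map_mul, mul_comm]

/-- The element of the shift monoid given by an input vector. -/
def shiftElt (n : N.Letter → ℕ) : N.ShiftMonoid :=
  ⟨N.phi (Multiplicative.ofAdd n), Multiplicative.ofAdd n, rfl⟩

/-- The Grothendieck group of the shift monoid. -/
abbrev Groth : Type (max u w x) := Algebra.GrothendieckGroup N.ShiftMonoid

/-- The class in the Grothendieck group of the pair of shifts by two input vectors. -/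
def grothPair (n n' : N.Letter → ℕ) : N.Groth :=
  Localization.mk (N.shiftElt n) ⟨N.shiftElt n', Submonoid.mem_top _⟩

/-- The torsion group of the network. -/
def Tor : Subgroup N.Groth := CommGroup.torsion N.Groth

/-- A recurrent component is invertible if for every `g` in the torsion group and every
representative of `g` by a pair of input vectors `n, n'`, the shift of the component by `n` is
the shift by `n'` of some recurrent component. -/
def IsInvertible (C : N.Lrec) : Prop :=
  ∀ g ∈ N.Tor, ∀ n n' : N.Letter → ℕ, g = N.grothPair n n' →
    ∃ C' : N.Lrec, N.shift n C = N.shift n' C'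

/-- The set of invertible recurrent components. -/
def LrecInv : Type (max u w x) := {C : N.Lrec // N.IsInvertible C}

end Dynamics

section Production

variable {V : Type u} [Quiver.{v} V] (N : AbelianNetwork.{u, v, w, x} V)

section Vectors

variable [Fintype V] [∀ v, Fintype (N.Alph v)]

/-- Some word containing each letter `a` exactly `n a` times. -/
def wordOf (n : N.Letter → ℕ) : List N.Letter := (exists_wordVec n).choose

theorem wordVec_wordOf (n : N.Letter → ℕ) : wordVec (N.wordOf n) = n :=
  (exists_wordVec n).choose_spec

theorem wordOf_perm (w : List N.Letter) : (N.wordOf (wordVec w)).Perm w :=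
  wordVec_eq_iff_perm.1 (N.wordVec_wordOf _)

theorem wordOf_add_perm (m n : N.Letter → ℕ) :
    (N.wordOf (m + n)).Perm (N.wordOf m ++ N.wordOf n) := by
  rw [← wordVec_eq_iff_perm, wordVec_append, wordVec_wordOf, wordVec_wordOf, wordVec_wordOf]

/-- The transition function of a vector, i.e. of any word with that letter count. -/
def tVec (n : N.Letter → ℕ) (q : N.State) : N.State := N.tWord (N.wordOf n) q

theorem tVec_wordVec (w : List N.Letter) (q : N.State) : N.tVec (wordVec w) q = N.tWord w q :=
  N.tWord_perm (N.wordOf_perm w) q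

theorem tVec_add (m n : N.Letter → ℕ) (q : N.State) :
    N.tVec (m + n) q = N.tVec n (N.tVec m q) := by
  rw [tVec, N.tWord_perm (N.wordOf_add_perm m n), tWord_append, tVec, tVec]

theorem tVec_comm (m n : N.Letter → ℕ) (q : N.State) :
    N.tVec m (N.tVec n q) = N.tVec n (N.tVec m q) := by
  rw [← tVec_add, ← tVec_add, add_comm]

theorem tVec_zero (q : N.State) : N.tVec 0 q = q :=
  N.tVec_wordVec [] q

theorem exists_tVec_of_mem (f : Function.End N.State) (hf : f ∈ N.transitionMonoid) :
    ∃ n, f = N.tVec n := by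
  induction hf using Submonoid.closure_induction with
  | mem f hf =>
    obtain ⟨a, rfl⟩ := hf
    refine ⟨wordVec [a], ?_⟩
    funext q
    rw [tVec_wordVec]
    rfl
  | one =>
    refine ⟨0, ?_⟩
    funext q
    rw [tVec_zero]
    rfl
  | mul f g _ _ hf hg =>
    obtain ⟨m, rfl⟩ := hf
    obtain ⟨n, rfl⟩ := hg
    refine ⟨n + m, ?_⟩
    funext q
    rw [tVec_add]
    rfl

theorem tWord_mem (w : List N.Letter) :
    (N.tWord w : Function.End N.State) ∈ N.transitionMonoid := by
  induction w with
  | nil => exact N.transitionMonoid.one_mem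
  | cons a w ih =>
    exact N.transitionMonoid.mul_mem ih (Submonoid.subset_closure ⟨a, rfl⟩)

/-- The element of the transition monoid given by a vector. -/
def tElt (n : N.Letter → ℕ) : N.transitionMonoid := ⟨N.tVec n, N.tWord_mem _⟩

theorem tElt_add (m n : N.Letter → ℕ) : N.tElt (m + n) = N.tElt m * N.tElt n := by
  rw [mul_comm (N.tElt m)]
  refine Subtype.ext ?_
  funext q
  exact N.tVec_add m n q

theorem tElt_nsmul (k : ℕ) (n : N.Letter → ℕ) : N.tElt (k • n) = N.tElt n ^ k := by
  induction k with
  | zero =>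
    rw [zero_smul, pow_zero]
    refine Subtype.ext ?_
    funext q
    exact N.tVec_zero q
  | succ k ih => rw [succ_nsmul, tElt_add, ih, pow_succ]

end Vectors

theorem exists_idempotent_pow {M : Type*} [CommMonoid M] [Finite M] (m : M) :
    ∃ k, 1 ≤ k ∧ m ^ k * m ^ k = m ^ k := by
  obtain ⟨i, j, hij, h⟩ := Finite.exists_ne_map_eq_of_infinite fun i : ℕ => m ^ i
  wlog hlt : i < j generalizing i j
  · exact this j i hij.symm h.symm (lt_of_le_of_ne (not_lt.1 hlt) hij.symm)
  obtain ⟨p, rfl⟩ := Nat.exists_eq_add_of_lt hlt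
  have h1 : ∀ r, m ^ (i + r * (p + 1)) = m ^ i := by
    intro r
    induction r with
    | zero => simp
    | succ r ih =>
      rw [show i + (r + 1) * (p + 1) = (i + p + 1) + r * (p + 1) by ring, pow_add, ← h, ← pow_add,
        ih]
  refine ⟨(i + 1) * (p + 1), Nat.mul_pos (Nat.succ_pos _) (Nat.succ_pos _), ?_⟩
  obtain ⟨s, hs⟩ : ∃ s, (i + 1) * (p + 1) = i + s :=
    Nat.exists_eq_add_of_le (by nlinarith)
  rw [← pow_add]
  conv_lhs => rw [show (i + 1) * (p + 1) + (i + 1) * (p + 1)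
    = (i + (i + 1) * (p + 1)) + s by omega]
  rw [pow_add, h1, ← pow_add, ← hs]

theorem minimalIdempotent_mul {M : Type*} [CommMonoid M] [Finite M] (f : M) (hf : f * f = f) :
    f * minimalIdempotent M = minimalIdempotent M := by
  have hfin : {f : M | f * f = f}.Finite := Set.toFinite _
  rw [minimalIdempotent, finprod_mem_eq_finite_toFinset_prod _ hfin,
    ← Finset.mul_prod_erase _ _ (hfin.mem_toFinset.2 hf), ← mul_assoc, hf]

theorem minimalIdempotent_mul_self {M : Type*} [CommMonoid M] [Finite M] :
    minimalIdempotent M * minimalIdempotent M = minimalIdempotent M := by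
  have hfin : {f : M | f * f = f}.Finite := Set.toFinite _
  rw [minimalIdempotent, finprod_mem_eq_finite_toFinset_prod _ hfin, ← Finset.prod_mul_distrib]
  exact Finset.prod_congr rfl fun f hf => hfin.mem_toFinset.1 hf

variable [Fintype V] [∀ v, Fintype (N.Alph v)] [∀ v, Finite (N.St v)]

instance instFiniteTransitionMonoid : Finite N.transitionMonoid :=
  have : Finite (Function.End N.State) := inferInstanceAs (Finite (N.State → N.State))
  inferInstance

/-- A uniform period of the action of a vector on the locally recurrent states. -/
theorem exists_period (n : N.Letter → ℕ) : ∃ k, 1 ≤ k ∧ ∀ q ∈ N.Loc, N.tVec (k • n) q = q := by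
  obtain ⟨k, hk, h⟩ := exists_idempotent_pow (N.tElt n)
  refine ⟨k, hk, ?_⟩
  rintro _ ⟨q, rfl⟩
  have h1 := minimalIdempotent_mul _ h
  rw [← tElt_nsmul] at h1
  exact congrFun (congrArg Subtype.val h1) q

theorem tVec_mem_Loc (n : N.Letter → ℕ) {q : N.State} (hq : q ∈ N.Loc) : N.tVec n q ∈ N.Loc := by
  obtain ⟨q, rfl⟩ := hq
  refine ⟨N.tVec n q, ?_⟩
  exact congrFun (congrArg Subtype.val
    (mul_comm (minimalIdempotent N.transitionMonoid) (N.tElt n))) q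

theorem tVec_pred (k : ℕ) (hk : 1 ≤ k) (n : N.Letter → ℕ) (q : N.State) :
    N.tVec ((k - 1) • n) (N.tVec n q) = N.tVec (k • n) q := by
  rw [← tVec_add]
  congr 1
  obtain ⟨j, rfl⟩ := Nat.exists_eq_add_of_le' hk
  rw [Nat.add_sub_cancel, succ_nsmul, add_comm]

theorem tVec_injOn (n : N.Letter → ℕ) : Set.InjOn (N.tVec n) N.Loc := by
  intro q hq q' hq' h
  obtain ⟨k, hk, hper⟩ := N.exists_period n
  rw [← hper q hq, ← hper q' hq', ← N.tVec_pred k hk, h, N.tVec_pred k hk]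

theorem Loc_nonempty : N.Loc.Nonempty :=
  have : Nonempty N.State := ⟨fun v => (N.nonempty_St v).some⟩
  Set.range_nonempty _

/-- Two vectors with the same difference have the same effect simultaneously. -/
theorem tVec_eq_iff_of_sub_eq {m n m' n' : N.Letter → ℕ} (h : m + n' = m' + n) {q : N.State}
    (hq : q ∈ N.Loc) : N.tVec m q = N.tVec n q ↔ N.tVec m' q = N.tVec n' q := by
  rw [← (N.tVec_injOn n').eq_iff (N.tVec_mem_Loc m hq) (N.tVec_mem_Loc n hq),
    ← (N.tVec_injOn n).eq_iff (N.tVec_mem_Loc m' hq) (N.tVec_mem_Loc n' hq),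
    ← tVec_add, ← tVec_add, ← tVec_add, ← tVec_add, h, add_comm n n']

/-- The total kernel. -/
def totalKernel : AddSubgroup (N.Letter → ℤ) where
  carrier := {z | ∀ q ∈ N.Loc,
    N.tVec (fun a => (z a)⁺.toNat) q = N.tVec (fun a => (z a)⁻.toNat) q}
  zero_mem' := fun q _ => by simp
  add_mem' := by
    intro y z hy hz q hq
    have h : N.tVec ((fun a => (y a)⁺.toNat) + fun a => (z a)⁺.toNat) q
        = N.tVec ((fun a => (y a)⁻.toNat) + fun a => (z a)⁻.toNat) q := by
      rw [tVec_add, tVec_add, hy q hq, hz _ (N.tVec_mem_Loc _ hq)]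
    refine (N.tVec_eq_iff_of_sub_eq ?_ hq).1 h
    funext a
    simp only [Pi.add_apply, posPart_def, negPart_def]
    omega
  neg_mem' := by
    intro z hz q hq
    simpa using (hz q hq).symm

theorem mem_totalKernel_iff (n : N.Letter → ℕ) :
    (fun a => (n a : ℤ)) ∈ N.totalKernel ↔ ∀ q ∈ N.Loc, N.tVec n q = q := by
  have h1 : (fun a => ((n a : ℤ)⁺).toNat) = n := by
    funext a
    simp
  have h2 : (fun a => ((n a : ℤ)⁻).toNat) = 0 := by
    funext a
    simp
  change (∀ q ∈ N.Loc, N.tVec (fun a => ((n a : ℤ)⁺).toNat) q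
    = N.tVec (fun a => ((n a : ℤ)⁻).toNat) q) ↔ _
  rw [h1, h2]
  simp only [tVec_zero]

variable [∀ u v : V, Fintype (u ⟶ v)]

/-- The message-passing vector of a vector, i.e. of any word with that letter count. -/
def outVec (n : N.Letter → ℕ) (q : N.State) : N.Letter → ℕ := N.outWord (N.wordOf n) q

theorem outVec_wordVec (w : List N.Letter) (q : N.State) :
    N.outVec (wordVec w) q = N.outWord w q :=
  N.outWord_perm (N.wordOf_perm w) q

theorem outVec_add (m n : N.Letter → ℕ) (q : N.State) :
    N.outVec (m + n) q = N.outVec m q + N.outVec n (N.tVec m q) := by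
  rw [outVec, N.outWord_perm (N.wordOf_add_perm m n), outWord_append, outVec, outVec, tVec]

theorem outVec_zero (q : N.State) : N.outVec 0 q = 0 :=
  N.outVec_wordVec [] q

/-- `P` is a production matrix if, for every locally recurrent state `q`, the rational linear map
`P` extends the map `k ↦ N_k(q)` from the nonnegative vectors in the total kernel. -/
def IsProductionMatrix (P : Matrix N.Letter N.Letter ℚ) : Prop :=
  ∀ q ∈ N.Loc, ∀ k : N.Letter → ℕ, (fun a => (k a : ℤ)) ∈ N.totalKernel →
    P.mulVec (fun a => (k a : ℚ)) = fun b => (N.outVec k q b : ℚ)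

theorem outVec_nsmul {k : N.Letter → ℕ} {q : N.State} (h : N.tVec k q = q) (c : ℕ) :
    N.tVec (c • k) q = q ∧ N.outVec (c • k) q = c • N.outVec k q := by
  induction c with
  | zero => simp only [zero_smul, tVec_zero, outVec_zero, and_self]
  | succ c ih => simp only [succ_nsmul, tVec_add, outVec_add, ih.1, ih.2, h, and_self]

theorem outVec_sum {ι : Type*} (s : Finset ι) (f : ι → N.Letter → ℕ) {q : N.State}
    (h : ∀ i, N.tVec (f i) q = q) :
    N.tVec (∑ i ∈ s, f i) q = q ∧ N.outVec (∑ i ∈ s, f i) q = ∑ i ∈ s, N.outVec (f i) q := by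
  induction s using Finset.induction_on with
  | empty => simp only [Finset.sum_empty, tVec_zero, outVec_zero, and_self]
  | insert i s hi ih =>
    simp only [Finset.sum_insert hi, tVec_add, outVec_add, ih.1, ih.2, h, and_self]

theorem exists_tVec_eq (hN : N.LocallyIrreducible) (q q' : N.State) (hq' : q' ∈ N.Loc) :
    ∃ n, N.tVec n q = q' := by
  obtain ⟨w, w', h⟩ := hN q q'
  obtain ⟨k, hk, hper⟩ := N.exists_period (wordVec w')
  refine ⟨wordVec w + (k - 1) • wordVec w', ?_⟩
  rw [tVec_add, tVec_wordVec, h, ← tVec_wordVec, N.tVec_pred k hk, hper q' hq']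

theorem outVec_eq_of_mem_totalKernel (hN : N.LocallyIrreducible) {q q' : N.State}
    (hq : q ∈ N.Loc) (hq' : q' ∈ N.Loc) {k : N.Letter → ℕ}
    (hk : (fun a => (k a : ℤ)) ∈ N.totalKernel) : N.outVec k q = N.outVec k q' := by
  obtain ⟨n, rfl⟩ := N.exists_tVec_eq hN q q' hq'
  have h := N.outVec_add k n q
  rw [add_comm k n, outVec_add, (N.mem_totalKernel_iff k).1 hk q hq, add_comm] at h
  exact (add_right_cancel h).symm

theorem exists_uniform_period :
    ∃ m : ℕ, 1 ≤ m ∧ ∀ a : N.Letter, (fun b => ((m • Pi.single a 1 : N.Letter → ℕ) b : ℤ))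
      ∈ N.totalKernel := by
  choose k hk hper using fun a : N.Letter => N.exists_period (Pi.single a 1)
  refine ⟨∏ a, k a, Nat.one_le_iff_ne_zero.2 (Finset.prod_ne_zero_iff.2 fun a _ =>
    Nat.one_le_iff_ne_zero.1 (hk a)), fun a => ?_⟩
  have h : (fun b => ((k a • Pi.single a 1 : N.Letter → ℕ) b : ℤ)) ∈ N.totalKernel :=
    (N.mem_totalKernel_iff _).2 (hper a)
  have h' := N.totalKernel.nsmul_mem h (∏ b ∈ Finset.univ.erase a, k b)
  convert h' using 1
  funext b
  rw [← Finset.prod_erase_mul _ _ (Finset.mem_univ a)]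
  simp only [Pi.smul_apply, smul_eq_mul, nsmul_eq_mul]
  push_cast
  ring

/-- A finite, locally irreducible network has exactly one production matrix. -/
theorem existsUnique_productionMatrix (hN : N.LocallyIrreducible) :
    ∃! P : Matrix N.Letter N.Letter ℚ, N.IsProductionMatrix P := by
  obtain ⟨m, hm, hK⟩ := N.exists_uniform_period
  obtain ⟨q₀, hq₀⟩ := N.Loc_nonempty
  have hm0 : (m : ℚ) ≠ 0 := by exact_mod_cast (by omega : m ≠ 0)
  refine ⟨fun b a => (N.outVec (m • Pi.single a 1) q₀ b : ℚ) / m, ?_, ?_⟩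
  · intro q hq k hk
    rw [N.outVec_eq_of_mem_totalKernel hN hq hq₀ hk]
    have key : m • N.outVec k q₀ = ∑ a, k a • N.outVec (m • Pi.single a 1) q₀ := by
      have hfix : ∀ a, N.tVec (m • Pi.single a 1) q₀ = q₀ := fun a =>
        (N.mem_totalKernel_iff _).1 (hK a) q₀ hq₀
      have hsum : m • k = ∑ a, k a • (m • Pi.single a 1 : N.Letter → ℕ) := by
        funext b
        rw [Finset.sum_apply, Finset.sum_eq_single b]
        · simp [mul_comm]
        · intro a _ hab
          simp [Pi.single_eq_of_ne' hab]
        · simp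
      rw [← (N.outVec_nsmul ((N.mem_totalKernel_iff k).1 hk q₀ hq₀) m).2, hsum,
        (N.outVec_sum _ _ fun a => (N.outVec_nsmul (hfix a) (k a)).1).2]
      exact Finset.sum_congr rfl fun a _ => (N.outVec_nsmul (hfix a) (k a)).2
    funext b
    have kb := congrFun key b
    simp only [Pi.smul_apply, Finset.sum_apply, smul_eq_mul] at kb
    have kb' : (m : ℚ) * N.outVec k q₀ b
        = ∑ a, (k a : ℚ) * N.outVec (m • Pi.single a 1) q₀ b := by exact_mod_cast kb
    simp only [Matrix.mulVec, dotProduct]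
    rw [← mul_right_inj' hm0, kb', Finset.mul_sum]
    refine Finset.sum_congr rfl fun a _ => ?_
    field_simp
  · intro P hP
    funext b a
    have h := congrFun (hP q₀ hq₀ _ (hK a)) b
    rw [eq_div_iff hm0, ← h]
    simp [Matrix.mulVec, dotProduct, Pi.single_apply]

/-- The production matrix of a finite, locally irreducible network. -/
def productionMatrix (hN : N.LocallyIrreducible) : Matrix N.Letter N.Letter ℚ :=
  (N.existsUnique_productionMatrix hN).choose

theorem isProductionMatrix_productionMatrix (hN : N.LocallyIrreducible) :
    N.IsProductionMatrix (N.productionMatrix hN) :=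
  (N.existsUnique_productionMatrix hN).choose_spec.1

/-- The subgroup `(I - P)K` of `ℤ^A`. -/
def imageKernel (hN : N.LocallyIrreducible) : AddSubgroup (N.Letter → ℤ) where
  carrier := {z | ∃ k ∈ N.totalKernel,
    (1 - N.productionMatrix hN).mulVec (fun a => (k a : ℚ)) = fun a => (z a : ℚ)}
  zero_mem' := ⟨0, N.totalKernel.zero_mem, by
    funext b
    simp [Matrix.mulVec, dotProduct]⟩
  add_mem' := by
    rintro y z ⟨k, hk, hy⟩ ⟨l, hl, hz⟩
    refine ⟨k + l, N.totalKernel.add_mem hk hl, ?_⟩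
    have h := Matrix.mulVec_add (1 - N.productionMatrix hN) (fun a => (k a : ℚ))
      fun a => (l a : ℚ)
    rw [hy, hz] at h
    convert h using 1
    · congr 1
      funext a
      simp
    · funext a
      simp
  neg_mem' := by
    rintro z ⟨k, hk, hz⟩
    refine ⟨-k, N.totalKernel.neg_mem hk, ?_⟩
    have h := Matrix.mulVec_neg (fun a => (k a : ℚ)) (1 - N.productionMatrix hN)
    rw [hz] at h
    convert h using 1
    · congr 1
    · funext a
      simp

end Production

end AbelianNetwork

end

noncomputable section

open scoped Classical

/-! Compare the legal relation with the weak relation, in which executions need not be legal. The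
weak relation is easy: it commutes with adding input, adding input can be cancelled, and over a
fixed locally recurrent state it identifies two inputs exactly when they differ by an element of `(I
- P)K` (`mem_imageKernel_iff`). The core of the proof is that the two relations agree on
configurations in recurrent components (`component_eq_of_weaklyRelated`).

For this, call a letter unbounded at `c` if legal executions from `c` process it arbitrarily often;
this depends only on the component. By the removal lemma, unbounded letters may be executed
illegally without leaving the component. In a recurrent component every other letter occurs
infinitely often in some infinite past, so executions of such letters can be undone inside the
component. Moreover all recurrent components have the same unbounded letters (`IsPast.unbounded`):
Dickson's lemma gives a vector that does not decrease under production, supported on the unbounded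
letters, and a vector extracted from a past that does not grow, and comparing their ratios at a
minimum produces a self-sustaining loop. A weak relation between two recurrent components can then
be split into an unbounded part, which is harmless, and a remaining part, which is undone on both
sides.

A recurrent component exists because, from sufficiently large input, the unbounded letters carry a
self-sustaining vector and the remaining letters a decaying one: repeat the first forever forwards
and the second forever backwards (`nonempty_Lrec`).

Consequently `ℕ^A` acts on the recurrent components by injections, and two vectors act equally at
one component iff they differ by an element of `(I - P)K`, hence iff they act equally everywhere.
The shift monoid is thus the image of `ℕ^A` in `ℤ^A / (I - P)K`, and its Grothendieck group is the
whole quotient. This group is finitely generated, so its torsion is finite. Injectivity of the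
shifts makes the torsion action well defined and free, and shifting any recurrent component by all
denominators of the finitely many torsion elements gives an invertible one. -/

theorem wordVec_singleton_self {α : Type*} (a : α) : wordVec [a] a = 1 := by
  simp [wordVec]

namespace AbelianNetwork

/-! ### Executions of vectors, legal executions and the removal lemma -/

section Execution

variable {V : Type u} [Quiver.{v} V] (N : AbelianNetwork.{u, v, w, x} V) [Fintype V]
  [∀ v, Fintype (N.Alph v)] [∀ v, Finite (N.St v)] [∀ u v : V, Fintype (u ⟶ v)]

/-- The result of executing a vector, legally or not. -/
def exec (n : N.Letter → ℕ) (c : N.Config) : N.Config :=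
  (fun b => c.1 b + (N.outVec n c.2 b : ℤ) - (n b : ℤ), N.tVec n c.2)

theorem exec_zero (c : N.Config) : N.exec 0 c = c := by
  refine Prod.ext ?_ (N.tVec_zero c.2)
  funext b
  simp [exec, outVec_zero]

theorem exec_add (m n : N.Letter → ℕ) (c : N.Config) :
    N.exec (m + n) c = N.exec n (N.exec m c) := by
  refine Prod.ext ?_ (N.tVec_add m n c.2)
  funext b
  simp only [exec, outVec_add, Pi.add_apply]
  push_cast
  ring

theorem exec_comm (m n : N.Letter → ℕ) (c : N.Config) :
    N.exec m (N.exec n c) = N.exec n (N.exec m c) := by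
  rw [← exec_add, ← exec_add, add_comm]

theorem exec_singleton (a : N.Letter) (c : N.Config) :
    N.exec (wordVec [a]) c = N.confStep a c := by
  refine Prod.ext ?_ (N.tVec_wordVec [a] c.2)
  funext b
  simp [exec, outVec_wordVec, outWord, confStep]

theorem outVec_mono {m n : N.Letter → ℕ} (h : m ≤ n) (q : N.State) :
    N.outVec m q ≤ N.outVec n q := by
  obtain ⟨k, rfl⟩ := exists_add_of_le h
  rw [outVec_add]
  exact le_self_add

/-- The vectors of letter counts of the legal executions from a configuration. -/
inductive Legal : (N.Letter → ℕ) → N.Config → Prop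
  | zero (c : N.Config) : Legal 0 c
  | step (a : N.Letter) (n : N.Letter → ℕ) (c : N.Config) :
      1 ≤ c.1 a → Legal n (N.confStep a c) → Legal (wordVec [a] + n) c

variable {N}

theorem Legal.add {m n : N.Letter → ℕ} {c : N.Config} (hm : N.Legal m c)
    (hn : N.Legal n (N.exec m c)) : N.Legal (m + n) c := by
  induction hm with
  | zero c => rwa [zero_add, ← N.exec_zero c]
  | step a m c ha _ ih =>
    rw [add_assoc]
    refine .step a _ c ha (ih ?_)
    rwa [← N.exec_singleton, ← exec_add]

theorem Legal.singleton {a : N.Letter} {c : N.Config} (h : 1 ≤ c.1 a) :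
    N.Legal (wordVec [a]) c := by
  simpa using Legal.step a 0 c h (.zero _)

theorem Legal.reaches {n : N.Letter → ℕ} {c : N.Config} (h : N.Legal n c) :
    N.Reaches c (N.exec n c) := by
  induction h with
  | zero c => rw [exec_zero]; exact .refl
  | step a n c ha _ ih =>
    rw [exec_add, exec_singleton]
    exact .head ⟨a, ha, rfl⟩ ih

theorem Reaches.exists_legal {c c' : N.Config} (h : N.Reaches c c') :
    ∃ n, N.Legal n c ∧ N.exec n c = c' := by
  induction h with
  | refl => exact ⟨0, .zero c, N.exec_zero c⟩
  | tail _ h ih =>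
    obtain ⟨n, hn, rfl⟩ := ih
    obtain ⟨a, ha, rfl⟩ := h
    exact ⟨n + wordVec [a], hn.add (.singleton ha), by rw [exec_add, exec_singleton]⟩

theorem Legal.component_eq {n : N.Letter → ℕ} {c : N.Config} (h : N.Legal n c) :
    N.component (N.exec n c) = N.component c :=
  Quotient.sound (s := N.legalSetoid) ⟨_, .refl, h.reaches⟩

theorem component_eq_iff {c c' : N.Config} : N.component c = N.component c' ↔
    ∃ n n', N.Legal n c ∧ N.Legal n' c' ∧ N.exec n c = N.exec n' c' := by
  constructor
  · intro h
    obtain ⟨d, h1, h2⟩ := Quotient.exact (s := N.legalSetoid) h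
    obtain ⟨n, hn, rfl⟩ := Reaches.exists_legal h1
    obtain ⟨n', hn', h'⟩ := Reaches.exists_legal h2
    exact ⟨n, n', hn, hn', h'.symm⟩
  · rintro ⟨n, n', hn, hn', h⟩
    rw [← hn.component_eq, h, hn'.component_eq]

theorem le_confStep_of_ne {a b : N.Letter} (h : a ≠ b) (c : N.Config) :
    c.1 b ≤ (N.confStep a c).1 b := by
  simp only [confStep, wordVec_singleton_of_ne h]
  omega

/-- Processing another letter never lowers the input of `a`, so the first occurrence of `a` (if
there is one) can be moved to the front, legally or not, without disturbing the other steps. -/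
theorem Legal.tsub_singleton {n : N.Letter → ℕ} {c : N.Config} (h : N.Legal n c) (a : N.Letter) :
    N.Legal (n - wordVec [a]) (N.confStep a c) := by
  induction h with
  | zero c => rw [zero_tsub]; exact .zero _
  | step b n c hb hn ih =>
    by_cases hab : a = b
    · subst hab
      rwa [add_tsub_cancel_left]
    · have h : wordVec [b] + n - wordVec [a] = wordVec [b] + (n - wordVec [a]) := by
        funext d
        simp only [Pi.add_apply, Pi.sub_apply]
        by_cases had : a = d
        · subst had
          simp [wordVec_singleton_of_ne (Ne.symm hab)]
        · simp [wordVec_singleton_of_ne had]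
      rw [h]
      refine .step b _ _ (hb.trans (le_confStep_of_ne hab c)) ?_
      rw [confStep_comm]
      exact ih

/-- The removal lemma. -/
theorem Legal.tsub {n : N.Letter → ℕ} {c : N.Config} (h : N.Legal n c) (m : N.Letter → ℕ) :
    N.Legal (n - m) (N.exec m c) := by
  obtain ⟨w, rfl⟩ := exists_wordVec m
  induction w generalizing n c with
  | nil =>
    have h0 : wordVec ([] : List N.Letter) = 0 := rfl
    rwa [h0, tsub_zero, exec_zero]
  | cons a w ih =>
    rw [← List.singleton_append, wordVec_append, ← tsub_tsub, exec_add, exec_singleton]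
    exact ih (h.tsub_singleton a)

theorem Legal.sup {m n : N.Letter → ℕ} {c : N.Config} (hm : N.Legal m c) (hn : N.Legal n c) :
    N.Legal (m ⊔ n) c := by
  have h := hm.add (hn.tsub m)
  rwa [show m + (n - m) = m ⊔ n from by
    funext a
    simp only [Pi.add_apply, Pi.sub_apply, Pi.sup_apply]
    omega] at h

/-- Only a legal step at `a` can lower the input of `a`, and it starts from at least 1. This lower
bound makes inputs along legal executions accessible to Dickson's lemma. -/
theorem Legal.min_le {n : N.Letter → ℕ} {c : N.Config} (h : N.Legal n c) (a : N.Letter) :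
    min (c.1 a) 0 ≤ (N.exec n c).1 a := by
  induction h with
  | zero c => rw [exec_zero]; exact min_le_left _ _
  | step b n c hb hn ih =>
    rw [exec_add, exec_singleton]
    refine le_trans ?_ ih
    by_cases hab : b = a
    · subst hab
      have : 0 ≤ (N.confStep b c).1 b := by
        simp only [confStep, wordVec_singleton_self]
        omega
      simp [this]
    · have := le_confStep_of_ne hab c
      omega

theorem Legal.exec_nonneg {n : N.Letter → ℕ} {c : N.Config} (h : N.Legal n c) {a : N.Letter}
    (ha : 0 < n a) : 0 ≤ (N.exec n c).1 a := by
  induction h with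
  | zero c => simp at ha
  | step b n c hb hn ih =>
    rw [exec_add, exec_singleton]
    by_cases hab : b = a
    · subst hab
      have h0 : 0 ≤ (N.confStep b c).1 b := by
        simp only [confStep, wordVec_singleton_self]
        omega
      have := hn.min_le b
      omega
    · refine ih ?_
      simpa [wordVec_singleton_of_ne hab] using ha

/-- Legality of an execution depends only on the state and monotonically on the inputs of the
processed letters. -/
theorem Legal.of_le {n : N.Letter → ℕ} {c c' : N.Config} (h : N.Legal n c) (hq : c'.2 = c.2)
    (hx : ∀ a, 0 < n a → c.1 a ≤ c'.1 a) : N.Legal n c' := by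
  induction h generalizing c' with
  | zero c => exact .zero _
  | step b n c hb hn ih =>
    refine .step b n c' (hb.trans (hx b ?_)) (ih ?_ fun a ha => ?_)
    · simp [wordVec_singleton_self]
    · simp only [confStep, hq]
    · have := hx a (by simp [ha])
      simp only [confStep, hq]
      omega

theorem legal_nsmul_singleton (k : ℕ) {a : N.Letter} {c : N.Config} (h : (k : ℤ) ≤ c.1 a) :
    N.Legal (k • wordVec [a]) c := by
  induction k generalizing c with
  | zero => rw [zero_smul]; exact .zero c
  | succ k ih =>
    rw [succ_nsmul']
    refine .step a _ c (by push_cast at h; omega) (ih ?_)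
    simp only [confStep, wordVec_singleton_self]
    push_cast at h
    omega

/-! ### Letters that can be processed arbitrarily often -/

/-- The letter `a` can be processed arbitrarily often in legal executions from `c`. -/
def Unbounded (c : N.Config) (a : N.Letter) : Prop := ∀ k : ℕ, ∃ n, N.Legal n c ∧ k ≤ n a

/-- Backwards by the removal lemma: deleting the fixed vector `n` costs only `n a` occurrences of
`a`. -/
theorem unbounded_exec_iff {n : N.Letter → ℕ} {c : N.Config} (h : N.Legal n c) (a : N.Letter) :
    Unbounded (N.exec n c) a ↔ Unbounded c a := by
  constructor <;> intro hc k
  · obtain ⟨m, hm, hk⟩ := hc k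
    exact ⟨n + m, h.add hm, hk.trans (Nat.le_add_left _ _)⟩
  · obtain ⟨m, hm, hk⟩ := hc (k + n a)
    refine ⟨m - n, hm.tsub n, ?_⟩
    simp only [Pi.sub_apply]
    omega

theorem unbounded_congr {c c' : N.Config} (h : N.component c = N.component c') (a : N.Letter) :
    Unbounded c a ↔ Unbounded c' a := by
  obtain ⟨n, n', hn, hn', h⟩ := component_eq_iff.1 h
  rw [← unbounded_exec_iff hn, h, unbounded_exec_iff hn']

theorem exists_legal_ge (c : N.Config) (k : N.Letter → ℕ) :
    ∃ n, N.Legal n c ∧ ∀ a, Unbounded c a → k a ≤ n a := by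
  have key : ∀ s : Finset N.Letter,
      ∃ n, N.Legal n c ∧ ∀ a ∈ s, Unbounded c a → k a ≤ n a := by
    intro s
    induction s using Finset.induction_on with
    | empty => exact ⟨0, .zero c, by simp⟩
    | insert b s _ ih =>
      obtain ⟨n, hn, h⟩ := ih
      by_cases hb : Unbounded c b
      · obtain ⟨m, hm, hk⟩ := hb (k b)
        refine ⟨m ⊔ n, hm.sup hn, fun a ha hu => ?_⟩
        rcases Finset.mem_insert.1 ha with rfl | ha
        · exact hk.trans le_sup_left
        · exact (h a ha hu).trans le_sup_right
      · refine ⟨n, hn, fun a ha hu => ?_⟩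
        rcases Finset.mem_insert.1 ha with rfl | ha
        · exact absurd hu hb
        · exact h a ha hu
  obtain ⟨n, hn, h⟩ := key Finset.univ
  exact ⟨n, hn, fun a => h a (Finset.mem_univ a)⟩

/-- A legal vector `m ≥ n` exists, and by the removal lemma `m - n` is legal after the possibly
illegal `n`, so both routes meet legally at `N.exec m c`. -/
theorem component_exec_of_unbounded {c : N.Config} {n : N.Letter → ℕ}
    (h : ∀ a, 0 < n a → Unbounded c a) : N.component (N.exec n c) = N.component c := by
  obtain ⟨m, hm, hle⟩ := exists_legal_ge c n
  have hnm : n ≤ m := fun a => by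
    rcases Nat.eq_zero_or_pos (n a) with h0 | h0
    · rw [h0]; exact Nat.zero_le _
    · exact hle a (h a h0)
  rw [← hm.component_eq, ← (hm.tsub n).component_eq, ← exec_add, add_tsub_cancel_of_le hnm]

/-- A vector contained in a legal execution can be undone within the component. -/
theorem Legal.exists_undo {m n : N.Letter → ℕ} {c : N.Config} (h : N.Legal m c) (hnm : n ≤ m) :
    ∃ l, N.exec n (N.exec l c) = N.exec m c ∧
      N.component (N.exec l c) = N.component (N.exec m c) := by
  have hl : N.Legal n (N.exec (m - n) c) := by
    have := h.tsub (m - n)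
    rwa [tsub_tsub_cancel_of_le hnm] at this
  have he : N.exec n (N.exec (m - n) c) = N.exec m c := by
    rw [← exec_add, tsub_add_cancel_of_le hnm]
  exact ⟨m - n, he, by rw [← he, hl.component_eq]⟩

theorem exec_mem_Loc {c : N.Config} (hc : c.2 ∈ N.Loc) (n : N.Letter → ℕ) :
    (N.exec n c).2 ∈ N.Loc := N.tVec_mem_Loc n hc

theorem exec_injOn {c c' : N.Config} (hc : c.2 ∈ N.Loc) (hc' : c'.2 ∈ N.Loc)
    {n : N.Letter → ℕ} (h : N.exec n c = N.exec n c') : c = c' := by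
  have hq : c.2 = c'.2 := N.tVec_injOn n hc hc' (congrArg Prod.snd h)
  refine Prod.ext ?_ hq
  funext b
  have := congrFun (congrArg Prod.fst h) b
  simp only [exec, hq] at this
  omega

/-- Sufficiently long executions lead to locally recurrent states. -/
theorem exists_tVec_mem_Loc (N : AbelianNetwork.{u, v, w, x} V) [∀ v, Fintype (N.Alph v)]
    [∀ v, Finite (N.St v)] :
    ∃ k : N.Letter → ℕ, ∀ n, k ≤ n → ∀ q, N.tVec n q ∈ N.Loc := by
  obtain ⟨k, hk⟩ := N.exists_tVec_of_mem _ (minimalIdempotent N.transitionMonoid).2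
  refine ⟨k, fun n hn q => ?_⟩
  obtain ⟨l, rfl⟩ := exists_add_of_le hn
  rw [add_comm, tVec_add, ← hk]
  exact ⟨_, rfl⟩

/-- Two configurations are weakly related if executions, legal or not, lead from them to a common
configuration. -/
def WeaklyRelated (c c' : N.Config) : Prop := ∃ n n', N.exec n c = N.exec n' c'

theorem WeaklyRelated.trans {c c' c'' : N.Config} (h : WeaklyRelated c c')
    (h' : WeaklyRelated c' c'') : WeaklyRelated c c'' := by
  obtain ⟨m, m', h⟩ := h
  obtain ⟨n, n', h'⟩ := h'
  exact ⟨m + n, n' + m', by rw [exec_add, h, exec_comm, h', exec_add]⟩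

theorem weaklyRelated_of_component_eq {c c' : N.Config} (h : N.component c = N.component c') :
    WeaklyRelated c c' := by
  obtain ⟨n, n', -, -, h⟩ := component_eq_iff.1 h
  exact ⟨n, n', h⟩

end Execution

end AbelianNetwork

/-- A sequence in a well-quasi-order with finitely many colours has a monotone monochromatic
subsequence. -/
theorem exists_monotone_monochromatic_subseq {α κ : Type*} [Preorder α] [WellQuasiOrderedLE α]
    [Finite κ] (f : ℕ → α) (h : ℕ → κ) :
    ∃ g : ℕ → ℕ, StrictMono g ∧ Monotone (f ∘ g) ∧ ∀ i j, h (g i) = h (g j) := by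
  obtain ⟨y, hy⟩ := Finite.exists_infinite_fiber h
  have := hy
  set e := Nat.orderEmbeddingOfSet (h ⁻¹' {y})
  obtain ⟨g, hg⟩ := wellQuasiOrdered_le.exists_monotone_subseq (f ∘ e)
  have he : ∀ i, h (e i) = y := fun i =>
    (Nat.orderEmbeddingOfSet_range (h ⁻¹' {y})).subset ⟨i, rfl⟩
  exact ⟨e ∘ g, e.strictMono.comp g.strictMono, fun i j hij => hg i j hij,
    fun i j => (he _).trans (he _).symm⟩

namespace AbelianNetwork

/-! ### Periods, linear production, and the vector carried by the unbounded letters -/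

section Production

variable {V : Type u} [Quiver.{v} V] (N : AbelianNetwork.{u, v, w, x} V) [Fintype V]
  [∀ v, Fintype (N.Alph v)] [∀ v, Finite (N.St v)] [∀ u v : V, Fintype (u ⟶ v)]

/-- A common period of all letters on the locally recurrent states. -/
def period : ℕ := N.exists_uniform_period.choose

theorem period_pos : 0 < N.period := N.exists_uniform_period.choose_spec.1

theorem period_smul_singleton_mem (a : N.Letter) :
    (fun b => ((N.period • wordVec [a]) b : ℤ)) ∈ N.totalKernel := by
  have h : wordVec [a] = Pi.single a 1 := by
    funext b
    by_cases hab : a = b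
    · subst hab
      rw [wordVec_singleton_self, Pi.single_eq_same]
    · rw [wordVec_singleton_of_ne hab, Pi.single_eq_of_ne' hab]
  rw [h]
  exact N.exists_uniform_period.choose_spec.2 a

/-- The entry of the production matrix multiplied by the period: how many letters `b` are produced
when a period of the letter `a` is processed in a locally recurrent state. -/
def blockOut (b a : N.Letter) : ℕ := N.outVec (N.period • wordVec [a]) N.Loc_nonempty.some b

theorem tVec_period_smul (n : N.Letter → ℕ) {q : N.State} (hq : q ∈ N.Loc) :
    N.tVec (N.period • n) q = q := by
  obtain ⟨w, rfl⟩ := exists_wordVec n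
  induction w with
  | nil =>
    have h0 : wordVec ([] : List N.Letter) = 0 := rfl
    rw [h0, smul_zero, tVec_zero]
  | cons a w ih =>
    rw [← List.singleton_append, wordVec_append, smul_add, tVec_add,
      (N.mem_totalKernel_iff _).1 (N.period_smul_singleton_mem a) q hq, ih]

theorem period_smul_mem (n : N.Letter → ℕ) :
    (fun a => ((N.period • n) a : ℤ)) ∈ N.totalKernel :=
  (N.mem_totalKernel_iff _).2 fun _ hq => N.tVec_period_smul n hq

variable {N}

theorem outVec_period_smul (hN : N.LocallyIrreducible) (n : N.Letter → ℕ) {q : N.State}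
    (hq : q ∈ N.Loc) (b : N.Letter) :
    N.outVec (N.period • n) q b = ∑ a, N.blockOut b a * n a := by
  obtain ⟨w, rfl⟩ := exists_wordVec n
  induction w with
  | nil =>
    have h0 : wordVec ([] : List N.Letter) = 0 := rfl
    rw [h0, smul_zero, outVec_zero]
    simp
  | cons a w ih =>
    rw [← List.singleton_append, wordVec_append, smul_add, outVec_add,
      N.tVec_period_smul _ hq, Pi.add_apply, ih,
      N.outVec_eq_of_mem_totalKernel hN hq N.Loc_nonempty.some_mem
        (N.period_smul_singleton_mem a)]
    simp only [Pi.add_apply, mul_add, Finset.sum_add_distrib]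
    congr 1
    rw [Finset.sum_eq_single a]
    · rw [wordVec_singleton_self, mul_one]
      rfl
    · intro c _ hc
      rw [wordVec_singleton_of_ne (Ne.symm hc), mul_zero]
    · simp

/-- On whole periods the dynamics is linear: the state returns and the input changes by the integral
matrix `period * (P - I)`. All later inequalities are read off from this formula. -/
theorem exec_period_smul (hN : N.LocallyIrreducible) (n : N.Letter → ℕ) {c : N.Config}
    (hc : c.2 ∈ N.Loc) : N.exec (N.period • n) c =
      (fun b => c.1 b + ((∑ a, N.blockOut b a * n a : ℕ) : ℤ) - ((N.period * n b : ℕ) : ℤ),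
        c.2) := by
  refine Prod.ext ?_ (N.tVec_period_smul n hc)
  funext b
  simp only [exec, N.outVec_period_smul hN n hc b]
  rfl

theorem blockOut_le_outVec (hN : N.LocallyIrreducible) {n : N.Letter → ℕ} {q : N.State}
    (hq : q ∈ N.Loc) {a : N.Letter} {k : ℕ} (h : N.period * k ≤ n a) (b : N.Letter) :
    N.blockOut b a * k ≤ N.outVec n q b := by
  have hle : N.period • (k • wordVec [a]) ≤ n := fun c => by
    by_cases hac : a = c
    · subst hac
      simpa [wordVec_singleton_self] using h
    · simp [wordVec_singleton_of_ne hac]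
  refine le_trans ?_ (N.outVec_mono hle q b)
  rw [outVec_period_smul hN _ hq]
  refine le_trans (le_of_eq ?_) (Finset.single_le_sum (fun _ _ => Nat.zero_le _)
    (Finset.mem_univ a))
  simp [wordVec_singleton_self]

/-- Letters produced by letters that can be processed arbitrarily often have the same property. -/
theorem Unbounded.of_blockOut_pos (hN : N.LocallyIrreducible) {c : N.Config} (hc : c.2 ∈ N.Loc)
    {a b : N.Letter} (ha : Unbounded c a) (hab : 0 < N.blockOut b a) : Unbounded c b := by
  intro k
  -- That many blocks of `a` produce at least `2 * k + |c b|` letters `b`: at most `|c b|` offset a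
  -- negative input and fewer than `k` are consumed by `n`, so `k` remain to be processed.
  obtain ⟨n, hn, hk⟩ := ha (N.period * (2 * k + (c.1 b).natAbs))
  by_cases hb : k ≤ n b
  · exact ⟨n, hn, hb⟩
  refine ⟨n + k • wordVec [b], hn.add (legal_nsmul_singleton k ?_), ?_⟩
  · have h1 := blockOut_le_outVec hN hc hk b
    have h2 : 2 * k + (c.1 b).natAbs ≤ N.outVec n c.2 b :=
      le_trans (Nat.le_mul_of_pos_left _ hab) h1
    simp only [exec]
    omega
  · simp [wordVec_singleton_self]

theorem exists_bound_of_not_unbounded (c : N.Config) :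
    ∃ K : ℕ, ∀ a, ¬ Unbounded c a → ∀ n, N.Legal n c → n a < K := by
  have h : ∀ a, ∃ K : ℕ, ¬ Unbounded c a → ∀ n, N.Legal n c → n a < K := by
    intro a
    by_cases ha : Unbounded c a
    · exact ⟨0, fun h => absurd ha h⟩
    · have ha' := ha
      simp only [Unbounded, not_forall, not_exists, not_and, not_le] at ha'
      obtain ⟨K, hK⟩ := ha'
      exact ⟨K, fun _ n hn => hK n hn⟩
  choose K hK using h
  exact ⟨∑ a, K a, fun a ha n hn => (hK a ha n hn).trans_le
    (Finset.single_le_sum (fun _ _ => Nat.zero_le _) (Finset.mem_univ a))⟩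

theorem exists_period_smul_of_le {m n : N.Letter → ℕ} (hmn : m ≤ n)
    (h : ∀ a, m a % N.period = n a % N.period) : ∃ k : N.Letter → ℕ, n = m + N.period • k := by
  have h' : ∀ a, ∃ k, n a = m a + N.period * k := fun a => by
    obtain ⟨k, hk⟩ := (Nat.modEq_iff_dvd' (hmn a)).1 (h a)
    exact ⟨k, by have : m a ≤ n a := hmn a; omega⟩
  choose k hk using h'
  exact ⟨k, funext hk⟩

/-- The letters that can be processed arbitrarily often support a vector that is nondecreasing
under production. -/
theorem exists_le_blockOut (hN : N.LocallyIrreducible) {c : N.Config} (hc : c.2 ∈ N.Loc) :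
    ∃ n : N.Letter → ℕ, (∀ a, 0 < n a ↔ Unbounded c a) ∧
      ∀ a, N.period * n a ≤ ∑ b, N.blockOut a b * n b := by
  choose f hf hle using fun i : ℕ => exists_legal_ge c fun _ => i
  obtain ⟨K, hK⟩ := exists_bound_of_not_unbounded c
  -- Dickson's lemma makes counts and final inputs increase together. The shift by `|c a|` makes
  -- inputs nonnegative by `Legal.min_le`, so `toNat` loses nothing. The colours make the difference
  -- of two counts a multiple of the period and, since bounded counts stay below `K`, zero on
  -- bounded letters.
  obtain ⟨g, hg, hmono, hcol⟩ := exists_monotone_monochromatic_subseq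
    (fun i => (f i, fun a => ((N.exec (f i) c).1 a + ((c.1 a).natAbs : ℤ)).toNat))
    (fun i (a : N.Letter) => ((⟨f i a % N.period, Nat.mod_lt _ N.period_pos⟩,
      ⟨min (f i a) K, Nat.lt_succ_of_le (min_le_right _ _)⟩) : Fin N.period × Fin (K + 1)))
  -- Since `r ≤ g r`, every unbounded letter occurs in `f (g r)` strictly more often than in `f (g
  -- 0)`.
  set r := ∑ a, f (g 0) a + 1
  have h0r : g 0 ≤ g r := hg.monotone (Nat.zero_le r)
  have hm := hmono (Nat.zero_le r)
  have hfm : f (g 0) ≤ f (g r) := hm.1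
  have hc1 : ∀ a, f (g 0) a % N.period = f (g r) a % N.period := fun a => by
    have := congrArg Prod.fst (congrFun (hcol 0 r) a)
    simpa using this
  have hc2 : ∀ a, min (f (g 0) a) K = min (f (g r) a) K := fun a => by
    have := congrArg Prod.snd (congrFun (hcol 0 r) a)
    simpa using this
  obtain ⟨k, hk⟩ := exists_period_smul_of_le hfm hc1
  refine ⟨k, fun a => ⟨fun hka => ?_, fun ha => ?_⟩, fun a => ?_⟩
  · by_contra ha
    have h1 := hK a ha _ (hf (g 0))
    have h2 := hK a ha _ (hf (g r))
    have h3 := hc2 a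
    rw [min_eq_left h1.le, min_eq_left h2.le, hk] at h3
    have h4 : 0 < N.period * k a := Nat.mul_pos N.period_pos hka
    simp only [Pi.add_apply, Pi.smul_apply, smul_eq_mul] at h3
    omega
  · have h1 : f (g 0) a ≤ ∑ a, f (g 0) a :=
      Finset.single_le_sum (fun _ _ => Nat.zero_le _) (Finset.mem_univ a)
    have h2 := hle (g r) a ha
    have h3 : r ≤ g r := hg.le_apply
    have h4 : f (g 0) a < f (g r) a := by omega
    rw [hk] at h4
    simp only [Pi.add_apply, Pi.smul_apply, smul_eq_mul] at h4
    by_contra h0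
    simp [Nat.eq_zero_of_not_pos h0] at h4
  · have h1 : ((N.exec (f (g 0)) c).1 a + ((c.1 a).natAbs : ℤ)).toNat ≤
        ((N.exec (f (g r)) c).1 a + ((c.1 a).natAbs : ℤ)).toNat := hm.2 a
    have h2 := (hf (g 0)).min_le a
    have h3 := (hf (g r)).min_le a
    rw [hk, exec_add, exec_period_smul hN k (exec_mem_Loc hc _)] at h1 h3
    simp only at h1 h3
    have h4 : ((N.period * k a : ℕ) : ℤ) ≤ ((∑ b, N.blockOut a b * k b : ℕ) : ℤ) := by omega
    exact_mod_cast h4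

end Production

/-! ### Existence of a recurrent component -/

section Existence

variable {V : Type u} [Quiver.{v} V] {N : AbelianNetwork.{u, v, w, x} V} [Fintype V]
  [∀ v, Fintype (N.Alph v)] [∀ v, Finite (N.St v)] [∀ u v : V, Fintype (u ⟶ v)]

/-- The alphabet splits into a part that can sustain itself and a part that decays. -/
theorem exists_sustained_decaying (hN : N.LocallyIrreducible) :
    ∃ n n' : N.Letter → ℕ, (∀ a, 0 < n a ∨ 0 < n' a) ∧
      (∀ a, 0 < n a → N.period * n a ≤ ∑ b, N.blockOut a b * n b) ∧
      (∀ a, 0 < n' a → ∑ b, N.blockOut a b * n' b ≤ N.period * n' a) := by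
  obtain ⟨q, hq⟩ := N.Loc_nonempty
  -- The sum will absorb the error of rounding counts up to full periods; the extra 1 forces each
  -- bounded letter to be processed at least once.
  set c : N.Config := (fun a => ((∑ b, N.blockOut a b + 1 : ℕ) : ℤ), q) with hcdef
  obtain ⟨n, hn, hle⟩ := exists_le_blockOut hN (c := c) hq
  obtain ⟨K, hK⟩ := exists_bound_of_not_unbounded c
  set D : Finset N.Letter := Finset.univ.filter fun a => ¬ Unbounded c a with hD
  have hmemD : ∀ a, a ∈ D ↔ ¬ Unbounded c a := fun a => by simp [hD]
  -- A legal execution maximal on the bounded letters leaves none of them with positive input, so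
  -- each is consumed at least as often as it is supplied.
  obtain ⟨l, hl, hmax⟩ : ∃ l, N.Legal l c ∧ ∀ l', N.Legal l' c → ∑ a ∈ D, l' a ≤ ∑ a ∈ D, l a := by
    have hne : {s : ℕ | ∃ l, N.Legal l c ∧ ∑ a ∈ D, l a = s}.Nonempty := ⟨_, 0, .zero c, rfl⟩
    have hbdd : BddAbove {s : ℕ | ∃ l, N.Legal l c ∧ ∑ a ∈ D, l a = s} := by
      refine ⟨∑ a ∈ D, K, ?_⟩
      rintro _ ⟨l, hl, rfl⟩
      exact Finset.sum_le_sum fun a ha => (hK a ((hmemD a).1 ha) l hl).le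
    obtain ⟨l, hl, hs⟩ := Nat.sSup_mem hne hbdd
    exact ⟨l, hl, fun l' hl' => hs ▸ le_csSup hbdd ⟨l', hl', rfl⟩⟩
  have hhalt : ∀ a ∈ D, ∑ b, N.blockOut a b + 1 + N.outVec l q a ≤ l a := by
    intro a ha
    by_contra hlt
    have h1 : 1 ≤ (N.exec l c).1 a := by
      simp only [exec, hcdef]
      omega
    have h2 := hmax _ (hl.add (.singleton h1))
    have h3 : ∑ b ∈ D, l b < ∑ b ∈ D, (l + wordVec [a]) b :=
      Finset.sum_lt_sum (fun b _ => Nat.le_add_right _ _)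
        ⟨a, ha, by simp [wordVec_singleton_self]⟩
    omega
  -- The number of periods needed to cover `l`, rounded up, on the bounded letters.
  set n' : N.Letter → ℕ := fun a => if a ∈ D then (l a + N.period - 1) / N.period else 0 with hn'
  have hp := N.period_pos
  have hceil : ∀ a ∈ D, l a ≤ N.period * n' a ∧ N.period * n' a ≤ l a + N.period := by
    intro a ha
    simp only [hn', if_pos ha]
    have h1 := Nat.div_add_mod (l a + N.period - 1) N.period
    have h2 := Nat.mod_lt (l a + N.period - 1) hp
    omega
  have hzero : ∀ a, a ∉ D → n' a = 0 := fun a ha => by simp only [hn', if_neg ha]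
  refine ⟨n, n', fun a => ?_, fun a _ => hle a, fun a ha => ?_⟩
  · by_cases ha : Unbounded c a
    · exact Or.inl ((hn a).2 ha)
    · right
      have h1 := hhalt a ((hmemD a).2 ha)
      have h2 := (hceil a ((hmemD a).2 ha)).1
      by_contra h0
      rw [Nat.eq_zero_of_not_pos h0] at h2
      omega
  · have haD : a ∈ D := by
      by_contra h
      rw [hzero a h] at ha
      exact absurd ha (lt_irrefl 0)
    set l' : N.Letter → ℕ := fun a => if a ∈ D then l a else 0 with hl'
    have hl'l : l' ≤ l := fun b => by
      simp only [hl']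
      split_ifs <;> omega
    have hl'n : l' ≤ N.period • n' := fun b => by
      simp only [hl']
      split_ifs with hb
      · exact (hceil b hb).1
      · exact Nat.zero_le _
    obtain ⟨δ, hδ⟩ := exists_add_of_le hl'n
    -- The rounding error is at most one period of each letter, so it produces at most `∑ b,
    -- N.blockOut a b` letters `a`, which is the initial input less one.
    have hδle : δ ≤ N.period • (fun _ => 1) := fun b => by
      have h1 := congrFun hδ b
      simp only [Pi.add_apply, Pi.smul_apply, smul_eq_mul, hl'] at h1 ⊢
      split_ifs at h1 with hb
      · have := (hceil b hb).2
        omega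
      · rw [hzero b hb] at h1
        omega
    rw [← outVec_period_smul hN n' hq a, hδ, outVec_add]
    have h1 : N.outVec l' q a ≤ N.outVec l q a := N.outVec_mono hl'l q a
    have h2 := N.outVec_mono hδle (N.tVec l' q) a
    rw [outVec_period_smul hN _ (N.tVec_mem_Loc l' hq)] at h2
    simp only [mul_one] at h2
    have h3 := hhalt a haD
    have h4 := (hceil a haD).1
    simp only [Pi.add_apply]
    omega

theorem component_eq_of_edge {a : N.Letter} {c c' : N.Config} (h : N.Edge a c c') :
    N.component c = N.component c' :=
  Quotient.sound (s := N.legalSetoid) ⟨c', .single ⟨a, h⟩, .refl⟩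

/-- The letter at a position of the periodic repetition of a word. -/
def periodicLetter {α : Type*} (w : List α) (hw : w ≠ []) (i : ℤ) : α :=
  w.get ⟨(i % (w.length : ℤ)).toNat, by
    have hpos : (0 : ℤ) < w.length := by exact_mod_cast List.length_pos_iff.2 hw
    have := Int.emod_lt_of_pos i hpos
    have := Int.emod_nonneg i hpos.ne'
    omega⟩

theorem periodicLetter_add_mul {α : Type*} (w : List α) (hw : w ≠ []) (j : Fin w.length)
    (k : ℤ) : periodicLetter w hw (j + w.length * k) = w.get j := by
  have h : (((j : ℕ) : ℤ) + (w.length : ℤ) * k) % (w.length : ℤ) = (j : ℕ) := by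
    rw [Int.add_mul_emod_self_left]
    exact Int.emod_eq_of_lt (Int.natCast_nonneg _) (by exact_mod_cast j.2)
  simp only [periodicLetter, h, Int.toNat_natCast]

/-- The walk that executes a word periodically, starting its periods at the configurations `β`. -/
def periodicWalk (w : List N.Letter) (β : ℤ → N.Config) (i : ℤ) : N.Config :=
  N.exec (wordVec (w.take (i % (w.length : ℤ)).toNat)) (β (i / w.length))

/-- The input at the start of the block pays for the whole word even without counting what is
produced on the way. -/
theorem edge_periodicWalk {w : List N.Letter} (hw : w ≠ []) {β : ℤ → N.Config} {i : ℤ}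
    (hx : ∀ a, 0 < wordVec w a → (wordVec w a : ℤ) ≤ (β (i / w.length)).1 a)
    (hβ : N.exec (wordVec w) (β (i / w.length)) = β (i / w.length + 1)) :
    N.Edge (periodicLetter w hw i) (periodicWalk w β i) (periodicWalk w β (i + 1)) := by
  have hpos : (0 : ℤ) < w.length := by exact_mod_cast List.length_pos_iff.2 hw
  have h1 := Int.emod_lt_of_pos i hpos
  have h2 := Int.emod_nonneg i hpos.ne'
  have h3 := Int.mul_ediv_add_emod i w.length
  set k := i / (w.length : ℤ) with hk
  obtain ⟨j, hj⟩ := Int.eq_ofNat_of_zero_le h2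
  have hjl : j < w.length := by omega
  have hlet : periodicLetter w hw i = w[j] := by
    simp only [periodicLetter, hj, List.get_eq_getElem, Int.toNat_natCast]
  have htake : wordVec (w.take (j + 1)) = wordVec (w.take j) + wordVec [w[j]] := by
    rw [List.take_succ_eq_append_getElem hjl, wordVec_append]
  have hsplit : wordVec w = wordVec (w.take (j + 1)) + wordVec (w.drop (j + 1)) := by
    rw [← wordVec_append, List.take_append_drop]
  rw [hlet]
  constructor
  · have h4 : wordVec (w.take j) w[j] + 1 ≤ wordVec w w[j] := by
      rw [hsplit, htake]
      simp only [Pi.add_apply, wordVec_singleton_self]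
      omega
    have h5 := hx w[j] (by omega)
    simp only [periodicWalk, hj, exec, ← hk, Int.toNat_natCast]
    omega
  · rw [← exec_singleton]
    have hcur : periodicWalk w β i = N.exec (wordVec (w.take j)) (β k) := by
      simp only [periodicWalk, hj, ← hk, Int.toNat_natCast]
    rw [hcur, ← exec_add, ← htake]
    by_cases hlast : j + 1 < w.length
    · have h6 : (i + 1) % (w.length : ℤ) = ((j + 1 : ℕ) : ℤ) := by
        have : i + 1 = ((j + 1 : ℕ) : ℤ) + w.length * k := by push_cast; omega
        rw [this, Int.add_mul_emod_self_left]
        exact Int.emod_eq_of_lt (Int.natCast_nonneg _) (by exact_mod_cast hlast)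
      have h7 : (i + 1) / (w.length : ℤ) = k := by
        have : i + 1 = ((j + 1 : ℕ) : ℤ) + w.length * k := by push_cast; omega
        rw [this, Int.add_mul_ediv_left _ _ hpos.ne',
          Int.ediv_eq_zero_of_lt (Int.natCast_nonneg _) (by exact_mod_cast hlast), zero_add]
      simp only [periodicWalk, h6, h7, Int.toNat_natCast]
    · have hl : j + 1 = w.length := by omega
      have h5 : i + 1 = w.length * (k + 1) := by
        rw [mul_add, mul_one]
        omega
      have h6 : (i + 1) % (w.length : ℤ) = 0 := by rw [h5, Int.mul_emod_right]
      have h7 : (i + 1) / (w.length : ℤ) = k + 1 := by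
        rw [h5, Int.mul_ediv_cancel_left _ hpos.ne']
      rw [hl, List.take_length, hβ]
      simp only [periodicWalk, h6, h7, Int.toNat_zero, List.take_zero]
      exact (N.exec_zero _).symm

theorem infinite_periodicLetter_eq {α : Type*} {w : List α} (hw : w ≠ []) {a : α} (ha : a ∈ w)
    (s : ℤ → Prop) (hs : (∀ i, 0 ≤ i → s i) ∨ ∀ i, i < 0 → s i) :
    {i | s i ∧ periodicLetter w hw i = a}.Infinite := by
  have hpos : (0 : ℤ) < w.length := by exact_mod_cast List.length_pos_iff.2 hw
  obtain ⟨j, rfl⟩ := List.mem_iff_get.1 ha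
  have hj : ((j : ℕ) : ℤ) < w.length := by exact_mod_cast j.2
  rcases hs with hs | hs
  · refine Set.infinite_of_injective_forall_mem
      (f := fun k : ℕ => ((j : ℕ) : ℤ) + w.length * (k : ℤ)) (fun k l h => ?_) fun k =>
        ⟨hs _ ?_, periodicLetter_add_mul w hw j _⟩
    · have h' : (w.length : ℤ) * k = w.length * l := by simpa using h
      exact_mod_cast mul_left_cancel₀ hpos.ne' h'
    · positivity
  · refine Set.infinite_of_injective_forall_mem
      (f := fun k : ℕ => ((j : ℕ) : ℤ) + w.length * (-(k : ℤ) - 1)) (fun k l h => ?_) fun k =>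
        ⟨hs _ ?_, periodicLetter_add_mul w hw j _⟩
    · have h' : (w.length : ℤ) * (-(k : ℤ) - 1) = w.length * (-(l : ℤ) - 1) := by simpa using h
      have := mul_left_cancel₀ hpos.ne' h'
      omega
    · have : (0 : ℤ) ≤ w.length * (k : ℤ) := by positivity
      simp only [mul_sub, mul_neg, mul_one]
      omega

theorem periodicWalk_zero (w : List N.Letter) (β : ℤ → N.Config) : periodicWalk w β 0 = β 0 := by
  simp only [periodicWalk, Int.zero_emod, Int.zero_ediv, Int.toNat_zero, List.take_zero]
  exact N.exec_zero _

theorem mem_iff_wordVec_pos {α : Type*} {w : List α} {a : α} : a ∈ w ↔ 0 < wordVec w a := by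
  rw [wordVec, List.count_pos_iff]

/-- The configurations reached after `i` periods of the vector `n`, starting with the input `x`. -/
def blockConf (x : N.Letter → ℤ) (q : N.State) (n : N.Letter → ℕ) (i : ℤ) : N.Config :=
  (fun b => x b + i * (((∑ a, N.blockOut b a * n a : ℕ) : ℤ) - ((N.period * n b : ℕ) : ℤ)), q)

theorem edge_periodicWalk_blockConf (hN : N.LocallyIrreducible) {x : N.Letter → ℤ} {q : N.State}
    (hq : q ∈ N.Loc) {n : N.Letter → ℕ} (hx : ∀ a, ((N.period * n a : ℕ) : ℤ) ≤ x a)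
    {w : List N.Letter} (hw : w ≠ []) (hwn : wordVec w = N.period • n) {i : ℤ}
    (hi : ∀ a, 0 < n a → 0 ≤ (i / (w.length : ℤ)) *
      (((∑ b, N.blockOut a b * n b : ℕ) : ℤ) - ((N.period * n a : ℕ) : ℤ))) :
    N.Edge (periodicLetter w hw i) (periodicWalk w (blockConf x q n) i)
      (periodicWalk w (blockConf x q n) (i + 1)) := by
  refine edge_periodicWalk hw (fun a ha => ?_) ?_
  · rw [hwn] at ha ⊢
    have h1 := hi a (Nat.pos_of_mul_pos_left ha)
    have h2 := hx a
    simp only [blockConf, Pi.smul_apply, smul_eq_mul]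
    omega
  · rw [hwn, exec_period_smul hN n (by exact hq)]
    refine Prod.ext ?_ rfl
    funext b
    simp only [blockConf]
    ring

/-- A finite, locally irreducible network has a recurrent component. -/
theorem nonempty_Lrec [Nonempty N.Letter] (hN : N.LocallyIrreducible) : Nonempty N.Lrec := by
  obtain ⟨n, n', hpos, hn, hn'⟩ := exists_sustained_decaying hN
  obtain ⟨q, hq⟩ := N.Loc_nonempty
  obtain ⟨w, hw⟩ := exists_wordVec (N.period • n)
  obtain ⟨w', hw'⟩ := exists_wordVec (N.period • n')
  -- Enough input for one block of either kind. On their own supports, `n`-blocks do not lower the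
  -- input forwards and `n'`-blocks do not lower it backwards, so both can be repeated forever.
  set x : N.Letter → ℤ := fun a => ((N.period * n a : ℕ) : ℤ) + ((N.period * n' a : ℕ) : ℤ)
  have hmem : ∀ a, a ∈ w ∨ a ∈ w' := fun a => by
    rw [mem_iff_wordVec_pos, mem_iff_wordVec_pos, hw, hw']
    exact (hpos a).imp (Nat.mul_pos N.period_pos) (Nat.mul_pos N.period_pos)
  have hfwd : ∀ (h : w ≠ []) (i : ℤ), 0 ≤ i → N.Edge (periodicLetter w h i)
      (periodicWalk w (blockConf x q n) i) (periodicWalk w (blockConf x q n) (i + 1)) := by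
    intro h i hi
    refine edge_periodicWalk_blockConf hN hq (fun a => ?_) h hw fun a ha => ?_
    · simp only [x]
      omega
    · refine mul_nonneg (Int.ediv_nonneg hi (Int.natCast_nonneg _)) (sub_nonneg.2 ?_)
      exact_mod_cast hn a ha
  have hbwd : ∀ (h : w' ≠ []) (i : ℤ), i < 0 → N.Edge (periodicLetter w' h i)
      (periodicWalk w' (blockConf x q n') i) (periodicWalk w' (blockConf x q n') (i + 1)) := by
    intro h i hi
    refine edge_periodicWalk_blockConf hN hq (fun a => ?_) h hw' fun a ha => ?_
    · simp only [x]
      omega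
    · refine mul_nonneg_of_nonpos_of_nonpos (Int.ediv_nonpos_of_nonpos_of_neg hi.le ?_)
        (sub_nonpos.2 ?_)
      · exact_mod_cast List.length_pos_iff.2 h
      · exact_mod_cast hn' a ha
  have hzero : periodicWalk w (blockConf x q n) 0 = periodicWalk w' (blockConf x q n') 0 := by
    simp only [periodicWalk_zero, blockConf, zero_mul, add_zero]
  -- The two half-infinite walks meet at time 0. If one of the words is empty, the other contains
  -- all letters and gives a one-sided walk.
  by_cases hwe : w = []
  · have hmem' : ∀ a, a ∈ w' := fun a => (hmem a).resolve_left (by simp [hwe])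
    have hwe' : w' ≠ [] := List.ne_nil_of_mem (hmem' (Classical.arbitrary _))
    have hedge : ∀ i : ℕ, N.Edge (periodicLetter w' hwe' (-((i : ℤ) + 1)))
        (periodicWalk w' (blockConf x q n') (-((i + 1 : ℕ) : ℤ)))
        (periodicWalk w' (blockConf x q n') (-(i : ℤ))) := fun i => by
      have := hbwd hwe' (-((i : ℤ) + 1)) (by omega)
      rwa [show -((i : ℤ) + 1) + 1 = -(i : ℤ) by ring] at this
    refine ⟨⟨N.component (blockConf x q n' 0), Or.inr (Or.inl
      ⟨fun i => periodicWalk w' (blockConf x q n') (-(i : ℤ)), _, hedge, fun b => ?_,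
        fun i => ?_⟩)⟩⟩
    · have h := infinite_periodicLetter_eq hwe' (hmem' b) (fun i => i < 0) (Or.inr fun i h => h)
      refine Set.Infinite.of_image (fun i : ℕ => -((i : ℤ) + 1)) (h.mono ?_)
      rintro i ⟨hi, hb⟩
      obtain ⟨k, hk⟩ := Int.eq_ofNat_of_zero_le (show 0 ≤ -i - 1 by omega)
      have hik : -((k : ℤ) + 1) = i := by omega
      exact ⟨k, by simpa only [Set.mem_ofPred_eq, hik] using hb, hik⟩
    · induction i with
      | zero => simp only [Nat.cast_zero, neg_zero, periodicWalk_zero]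
      | succ i ih => rw [component_eq_of_edge (hedge i), ih]
  by_cases hwe' : w' = []
  · have hmem' : ∀ a, a ∈ w := fun a => (hmem a).resolve_right (by simp [hwe'])
    have hedge : ∀ i : ℕ, N.Edge (periodicLetter w hwe i)
        (periodicWalk w (blockConf x q n) (i : ℤ))
        (periodicWalk w (blockConf x q n) ((i + 1 : ℕ) : ℤ)) := fun i => by
      have := hfwd hwe i (by omega)
      rwa [← Nat.cast_succ] at this
    refine ⟨⟨N.component (blockConf x q n 0), Or.inl
      ⟨fun i => periodicWalk w (blockConf x q n) i, _, hedge, fun b => ?_, fun i => ?_⟩⟩⟩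
    · have h := infinite_periodicLetter_eq hwe (hmem' b) (fun i => 0 ≤ i) (Or.inl fun i h => h)
      refine Set.Infinite.of_image (fun i : ℕ => (i : ℤ)) (h.mono ?_)
      rintro i ⟨hi, hb⟩
      obtain ⟨k, rfl⟩ := Int.eq_ofNat_of_zero_le hi
      exact ⟨k, hb, rfl⟩
    · induction i with
      | zero => simp only [Nat.cast_zero, periodicWalk_zero]
      | succ i ih => rw [← component_eq_of_edge (hedge i), ih]
  · set c : ℤ → N.Config := fun i => if 0 ≤ i then periodicWalk w (blockConf x q n) i
      else periodicWalk w' (blockConf x q n') i with hc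
    set a : ℤ → N.Letter := fun i => if 0 ≤ i then periodicLetter w hwe i
      else periodicLetter w' hwe' i with ha
    have hedge : ∀ i, N.Edge (a i) (c i) (c (i + 1)) := by
      intro i
      by_cases hi : 0 ≤ i
      · simp only [hc, ha, if_pos hi, if_pos (show 0 ≤ i + 1 by omega)]
        exact hfwd hwe i hi
      · have h := hbwd hwe' i (by omega)
        by_cases hi' : 0 ≤ i + 1
        · have hi0 : i + 1 = 0 := by omega
          simp only [hc, ha, if_neg hi, if_pos hi']
          rwa [hi0, hzero, ← hi0]
        · simp only [hc, ha, if_neg hi, if_neg hi']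
          exact h
    refine ⟨⟨N.component (c 0), Or.inr (Or.inr ⟨c, a, hedge, fun b => ?_, fun i => ?_⟩)⟩⟩
    · rcases hmem b with hb | hb
      · refine (infinite_periodicLetter_eq hwe hb (fun i => 0 ≤ i) (Or.inl fun i h => h)).mono ?_
        rintro i ⟨hi, hb⟩
        simpa only [Set.mem_ofPred_eq, ha, if_pos hi] using hb
      · refine (infinite_periodicLetter_eq hwe' hb (fun i => i < 0) (Or.inr fun i h => h)).mono ?_
        rintro i ⟨hi, hb⟩
        simpa only [Set.mem_ofPred_eq, ha, if_neg (not_le.2 hi)] using hb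
    · induction i using Int.induction_on with
      | zero => rfl
      | succ i ih => rw [← ih, component_eq_of_edge (hedge i)]
      | pred i ih =>
        rw [← ih, component_eq_of_edge (hedge (-(i : ℤ) - 1)), sub_add_cancel]

end Existence

end AbelianNetwork

theorem exists_le_sum_range_of_infinite {f : ℕ → ℕ} (h : {i | 0 < f i}.Infinite) (k : ℕ) :
    ∃ j, k ≤ ∑ i ∈ Finset.range j, f i := by
  induction k with
  | zero => exact ⟨0, Nat.zero_le _⟩
  | succ k ih =>
    obtain ⟨j, hj⟩ := ih
    obtain ⟨i, hi, hji⟩ := h.exists_gt j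
    refine ⟨i + 1, ?_⟩
    rw [Finset.sum_range_succ]
    have h1 : ∑ l ∈ Finset.range j, f l ≤ ∑ l ∈ Finset.range i, f l :=
      Finset.sum_le_sum_of_subset (Finset.range_mono hji.le)
    have h2 : 0 < f i := hi
    omega

theorem exists_le_sum_range_of_forall_infinite {α : Type*} [Finite α] {f : ℕ → α → ℕ}
    (k : α → ℕ) : ∃ j, ∀ a, {i | 0 < f i a}.Infinite → k a ≤ ∑ i ∈ Finset.range j, f i a := by
  have := Fintype.ofFinite α
  have h : ∀ a, ∃ j, {i | 0 < f i a}.Infinite → k a ≤ ∑ i ∈ Finset.range j, f i a := fun a => by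
    by_cases ha : {i | 0 < f i a}.Infinite
    · obtain ⟨j, hj⟩ := exists_le_sum_range_of_infinite ha (k a)
      exact ⟨j, fun _ => hj⟩
    · exact ⟨0, fun h => absurd h ha⟩
  choose j hj using h
  refine ⟨∑ a, j a, fun a ha => (hj a ha).trans ?_⟩
  exact Finset.sum_le_sum_of_subset (Finset.range_mono
    (Finset.single_le_sum (fun _ _ => Nat.zero_le _) (Finset.mem_univ a)))

namespace AbelianNetwork

/-! ### Infinite pasts of recurrent components -/

section Past

variable {V : Type u} [Quiver.{v} V] {N : AbelianNetwork.{u, v, w, x} V} [Fintype V]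
  [∀ v, Fintype (N.Alph v)] [∀ v, Finite (N.St v)] [∀ u v : V, Fintype (u ⟶ v)]

/-- `d` is a backward sequence of configurations, with legal executions of `n i` leading from
`d (i + 1)` to `d i`. -/
def IsPast (d : ℕ → N.Config) (n : ℕ → N.Letter → ℕ) : Prop :=
  ∀ i, N.Legal (n i) (d (i + 1)) ∧ N.exec (n i) (d (i + 1)) = d i

theorem IsPast.sum {d : ℕ → N.Config} {n : ℕ → N.Letter → ℕ} (h : IsPast d n) (i j : ℕ) :
    N.Legal (∑ l ∈ Finset.range j, n (i + l)) (d (i + j)) ∧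
      N.exec (∑ l ∈ Finset.range j, n (i + l)) (d (i + j)) = d i := by
  induction j with
  | zero =>
    rw [Finset.sum_range_zero]
    exact ⟨.zero _, N.exec_zero _⟩
  | succ j ih =>
    rw [Finset.sum_range_succ, add_comm, exec_add, ← add_assoc]
    obtain ⟨h1, h2⟩ := h (i + j)
    refine ⟨h1.add ?_, ?_⟩
    · rw [h2]
      exact ih.1
    · rw [h2]
      exact ih.2

theorem unbounded_of_walk {c : ℕ → N.Config} {a : ℕ → N.Letter}
    (h : ∀ i, N.Edge (a i) (c i) (c (i + 1))) {b : N.Letter} (hb : {i | a i = b}.Infinite) :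
    Unbounded (c 0) b := by
  have key : ∀ j, N.Legal (∑ i ∈ Finset.range j, wordVec [a i]) (c 0) ∧
      N.exec (∑ i ∈ Finset.range j, wordVec [a i]) (c 0) = c j := by
    intro j
    induction j with
    | zero =>
      rw [Finset.sum_range_zero]
      exact ⟨.zero _, N.exec_zero _⟩
    | succ j ih =>
      rw [Finset.sum_range_succ, exec_add, ih.2, exec_singleton]
      refine ⟨ih.1.add ?_, (h j).2⟩
      rw [ih.2]
      exact .singleton (h j).1
  have hb' : {i | 0 < wordVec [a i] b}.Infinite := hb.mono fun i hi => by
    have hi : a i = b := hi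
    rw [Set.mem_ofPred_eq, hi, wordVec_singleton_self]
    exact Nat.one_pos
  intro k
  obtain ⟨j, hj⟩ := exists_le_sum_range_of_infinite hb' k
  exact ⟨_, (key j).1, by rwa [Finset.sum_apply]⟩

/-- A past in which the remaining letters are unbounded can be moved into the locally recurrent
states. -/
theorem IsPast.exists_mem_Loc {d : ℕ → N.Config} {n : ℕ → N.Letter → ℕ} (h : IsPast d n)
    (hn : ∀ i a, 0 < n i a → {i | 0 < n i a}.Infinite)
    (hd : ∀ a, ¬ {i | 0 < n i a}.Infinite → Unbounded (d 0) a) :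
    ∃ d' : ℕ → N.Config, IsPast d' n ∧ (∀ i, (d' i).2 ∈ N.Loc) ∧
      N.component (d' 0) = N.component (d 0) ∧
      ∀ a, ¬ Unbounded (d' 0) a → {i | 0 < n i a}.Infinite := by
  obtain ⟨k, hk⟩ := exists_tVec_mem_Loc N
  -- Local recurrence needs `k a` occurrences of each letter. The past supplies those of its
  -- recurring letters; the others are unbounded and can be executed at once without changing the
  -- component.
  set p : N.Letter → ℕ := fun a => if {i | 0 < n i a}.Infinite then 0 else k a with hp
  have hcomp : N.component (N.exec p (d 0)) = N.component (d 0) := by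
    refine component_exec_of_unbounded fun a ha => hd a fun hinf => ?_
    simp only [hp, if_pos hinf, lt_self_iff_false] at ha
  refine ⟨fun i => N.exec p (d i), fun i => ⟨?_, ?_⟩, fun i => ?_, hcomp, fun a ha => ?_⟩
  · have h1 := (h i).1.tsub p
    convert h1 using 1
    funext a
    simp only [Pi.sub_apply]
    rcases Nat.eq_zero_or_pos (n i a) with h0 | h0
    · rw [h0, Nat.zero_sub]
    · simp only [hp, if_pos (hn i a h0), Nat.sub_zero]
  · change N.exec (n i) (N.exec p (d (i + 1))) = _
    rw [exec_comm, (h i).2]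
  · obtain ⟨j, hj⟩ := exists_le_sum_range_of_forall_infinite (f := n)
      fun a => k a + ∑ l ∈ Finset.range i, n l a
    change (N.exec p (d i)).2 ∈ N.Loc
    rw [← (h.sum i j).2, ← exec_add]
    refine hk _ (fun a => ?_) _
    change k a ≤ _
    rw [Pi.add_apply, Finset.sum_apply]
    by_cases ha : {i | 0 < n i a}.Infinite
    · have h1 := hj a ha
      have h2 : ∑ l ∈ Finset.range j, n l a ≤ ∑ l ∈ Finset.range (i + j), n l a :=
        Finset.sum_le_sum_of_subset (Finset.range_mono (Nat.le_add_left _ _))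
      rw [Finset.sum_range_add] at h2
      omega
    · simp only [hp, if_neg ha]
      omega
  · by_contra hinf
    exact ha ((unbounded_congr hcomp a).2 (hd a hinf))

/-- A recurrent component has a past through locally recurrent states, in which every letter that
cannot be processed arbitrarily often in the future is processed infinitely often. -/
theorem IsRecurrent.exists_past {C : N.Component} (hC : N.IsRecurrent C) :
    ∃ (d : ℕ → N.Config) (n : ℕ → N.Letter → ℕ), IsPast d n ∧ (∀ i, (d i).2 ∈ N.Loc) ∧
      N.component (d 0) = C ∧ ∀ a, ¬ Unbounded (d 0) a → {i | 0 < n i a}.Infinite := by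
  suffices h : ∃ (d : ℕ → N.Config) (n : ℕ → N.Letter → ℕ), IsPast d n ∧
      N.component (d 0) = C ∧ (∀ i a, 0 < n i a → {i | 0 < n i a}.Infinite) ∧
      ∀ a, ¬ {i | 0 < n i a}.Infinite → Unbounded (d 0) a by
    obtain ⟨d, n, h, hdC, hn, hd⟩ := h
    obtain ⟨d', h1, h2, h3, h4⟩ := h.exists_mem_Loc hn hd
    exact ⟨d', n, h1, h2, h3.trans hdC, h4⟩
  have hpos : ∀ a b : N.Letter, 0 < wordVec [a] b ↔ a = b := fun a b => by
    constructor
    · intro h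
      by_contra hab
      rw [wordVec_singleton_of_ne hab] at h
      exact absurd h (lt_irrefl 0)
    · rintro rfl
      rw [wordVec_singleton_self]
      exact Nat.one_pos
  rcases hC with ⟨c, a, h, hd, hc⟩ | ⟨c, a, h, hd, hc⟩ | ⟨c, a, h, hd, hc⟩
  -- Along a diverse forward walk all letters are unbounded, so a constant past with empty
  -- executions suffices.
  · refine ⟨fun _ => c 0, fun _ => 0, fun i => ⟨.zero _, N.exec_zero _⟩, hc 0, ?_, fun b _ =>
      unbounded_of_walk h (hd b)⟩
    intro i b hb
    exact absurd hb (lt_irrefl 0)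
  · have hinf : ∀ b, {i | 0 < wordVec [a i] b}.Infinite := fun b => by
      simpa only [hpos] using hd b
    refine ⟨c, fun i => wordVec [a i], fun i => ⟨.singleton (h i).1, ?_⟩, hc 0,
      fun _ b _ => hinf b, fun b hb => absurd (hinf b) hb⟩
    rw [exec_singleton]
    exact (h i).2
  -- Cut the walk so early that only letters recurring infinitely often in the past occur before the
  -- cut. The remaining letters occur infinitely often at nonnegative times, hence are unbounded.
  · have hT : ∀ b, ∃ T : ℕ, ∀ i : ℤ, i < -T → a i = b → {i | i < 0 ∧ a i = b}.Infinite := by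
      intro b
      by_cases hb : {i : ℤ | i < 0 ∧ a i = b}.Infinite
      · exact ⟨0, fun _ _ _ => hb⟩
      · obtain ⟨m, hm⟩ := (Set.not_infinite.1 hb).bddBelow
        refine ⟨m.natAbs, fun i hi hab => ?_⟩
        have := hm ⟨by omega, hab⟩
        omega
    choose T hT using hT
    set S : ℕ := ∑ b, T b
    have hS : ∀ i : ℤ, i < -S → ∀ b, a i = b → {i | i < 0 ∧ a i = b}.Infinite := by
      intro i hi b hb
      refine hT b i ?_ hb
      have : T b ≤ S := Finset.single_le_sum (fun _ _ => Nat.zero_le _) (Finset.mem_univ b)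
      omega
    have hpast : ∀ b, {i : ℤ | i < 0 ∧ a i = b}.Infinite →
        {i : ℕ | 0 < wordVec [a (-S - i - 1)] b}.Infinite := by
      intro b hb
      simp only [hpos]
      have h1 : {i : ℤ | i < -S ∧ a i = b}.Infinite := by
        refine (hb.sdiff (Set.finite_Ico (-(S : ℤ)) 0)).mono ?_
        rintro i ⟨⟨hi, hab⟩, hi'⟩
        refine ⟨?_, hab⟩
        by_contra hlt
        exact hi' ⟨by omega, hi⟩
      refine Set.Infinite.of_image (fun i : ℕ => -(S : ℤ) - i - 1) (h1.mono ?_)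
      rintro i ⟨hi, hab⟩
      obtain ⟨k, hk⟩ := Int.eq_ofNat_of_zero_le (show 0 ≤ -(S : ℤ) - i - 1 by omega)
      have hik : -(S : ℤ) - k - 1 = i := by omega
      exact ⟨k, by simpa only [Set.mem_ofPred_eq, hik] using hab, hik⟩
    refine ⟨fun i => c (-S - i), fun i => wordVec [a (-S - i - 1)], fun i => ?_, hc _, ?_, ?_⟩
    · have h1 := h (-S - i - 1)
      have e1 : -(S : ℤ) - ((i + 1 : ℕ) : ℤ) = -S - i - 1 := by push_cast; ring
      rw [show -(S : ℤ) - i - 1 + 1 = -S - i by ring] at h1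
      simp only [e1]
      exact ⟨.singleton h1.1, by rw [exec_singleton]; exact h1.2⟩
    · intro i b hb
      exact hpast b (hS _ (by omega) b ((hpos _ _).1 hb))
    · intro b hb
      have hfin : ¬ {i : ℤ | i < 0 ∧ a i = b}.Infinite := fun hinf => hb (hpast b hinf)
      have h1 : {i : ℤ | 0 ≤ i ∧ a i = b}.Infinite := by
        refine ((hd b).sdiff (Set.not_infinite.1 hfin)).mono ?_
        rintro i ⟨hab, hi⟩
        refine ⟨?_, hab⟩
        by_contra hlt
        exact hi ⟨by omega, hab⟩
      have h2 : Unbounded (c (0 : ℕ)) b := by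
        refine unbounded_of_walk (c := fun i : ℕ => c i) (a := fun i : ℕ => a i) (fun i => ?_) ?_
        · have := h i
          rwa [← Nat.cast_succ] at this
        · refine Set.Infinite.of_image (fun i : ℕ => (i : ℤ)) (h1.mono ?_)
          rintro i ⟨hi, hab⟩
          obtain ⟨k, rfl⟩ := Int.eq_ofNat_of_zero_le hi
          exact ⟨k, hab, rfl⟩
      exact (unbounded_congr ((hc _).trans (hc _).symm) b).1 h2

end Past

/-! ### Weakly related recurrent components coincide -/

section Weak

variable {V : Type u} [Quiver.{v} V] {N : AbelianNetwork.{u, v, w, x} V} [Fintype V]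
  [∀ v, Fintype (N.Alph v)] [∀ v, Finite (N.St v)] [∀ u v : V, Fintype (u ⟶ v)]

theorem IsPast.component_eq {d : ℕ → N.Config} {n : ℕ → N.Letter → ℕ} (h : IsPast d n) (j : ℕ) :
    N.component (d j) = N.component (d 0) := by
  have h1 := h.sum 0 j
  rw [zero_add] at h1
  rw [← h1.1.component_eq, h1.2]

/-- Some stretch of a past consists of full periods and does not increase the inputs of the letters
processed infinitely often. -/
theorem IsPast.exists_loop (hN : N.LocallyIrreducible) {d : ℕ → N.Config}
    {n : ℕ → N.Letter → ℕ} (h : IsPast d n) (hd : ∀ i, (d i).2 ∈ N.Loc) :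
    ∃ j k, N.Legal (N.period • k) (d j) ∧ ∀ a, {i | 0 < n i a}.Infinite →
      0 < k a ∧ ∑ b, N.blockOut a b * k b ≤ N.period * k a := by
  -- Along this subsequence inputs grow towards the past, so the execution from `d (g r)` to `d (g
  -- 0)` does not raise them; the colours make its vector a multiple of the period.
  obtain ⟨g, hg, hmono, hcol⟩ := exists_monotone_monochromatic_subseq
    (fun i a => ((d i).1 a).toNat)
    (fun i (a : N.Letter) => (⟨(∑ l ∈ Finset.range i, n l a) % N.period,
      Nat.mod_lt _ N.period_pos⟩ : Fin N.period))
  obtain ⟨r, hr⟩ := exists_le_sum_range_of_forall_infinite (f := n)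
    fun a => ∑ l ∈ Finset.range (g 0), n l a + 1
  have hr' : ∀ a, {i | 0 < n i a}.Infinite →
      ∑ l ∈ Finset.range (g 0), n l a < ∑ l ∈ Finset.range (g r), n l a := fun a ha =>
    Nat.lt_of_succ_le ((hr a ha).trans
      (Finset.sum_le_sum_of_subset (Finset.range_mono hg.le_apply)))
  obtain ⟨t, ht⟩ := Nat.exists_eq_add_of_le (hg.monotone (Nat.zero_le r))
  have hsum : ∑ l ∈ Finset.range (g r), n l =
      ∑ l ∈ Finset.range (g 0), n l + ∑ l ∈ Finset.range t, n (g 0 + l) := by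
    rw [ht, Finset.sum_range_add]
  obtain ⟨k, hk⟩ := exists_period_smul_of_le
    (m := ∑ l ∈ Finset.range (g 0), n l) (n := ∑ l ∈ Finset.range (g r), n l)
    (by rw [hsum]; exact le_self_add) (fun a => by
      have := congrFun (hcol 0 r) a
      simpa only [Finset.sum_apply, Fin.mk.injEq] using this)
  have hseg : ∑ l ∈ Finset.range t, n (g 0 + l) = N.period • k :=
    add_left_cancel (hsum.symm.trans hk)
  obtain ⟨h1, h2⟩ := h.sum (g 0) t
  rw [hseg, ← ht] at h1 h2
  refine ⟨g r, k, h1, fun a ha => ⟨?_, ?_⟩⟩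
  · have h3 := hr' a ha
    have h4 := congrFun hk a
    simp only [Pi.add_apply, Finset.sum_apply, Pi.smul_apply, smul_eq_mul] at h4
    by_contra h0
    rw [Nat.eq_zero_of_not_pos h0, mul_zero] at h4
    omega
  -- A letter processed earlier in a legal execution has nonnegative input now, so the truncation by
  -- `toNat` in the subsequence is harmless.
  · have hnonneg : ∀ i, 0 ≤ (d i).1 a := fun i => by
      obtain ⟨j, hj⟩ := exists_le_sum_range_of_forall_infinite (f := n)
        fun a => ∑ l ∈ Finset.range i, n l a + 1
      have h5 := hj a ha
      have h6 : ∑ l ∈ Finset.range j, n l a ≤ ∑ l ∈ Finset.range (i + j), n l a :=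
        Finset.sum_le_sum_of_subset (Finset.range_mono (Nat.le_add_left _ _))
      rw [Finset.sum_range_add] at h6
      have h7 := (h.sum i j).1.exec_nonneg (a := a) (by
        rw [Finset.sum_apply]
        omega)
      rwa [(h.sum i j).2] at h7
    have h3 : ((d (g 0)).1 a).toNat ≤ ((d (g r)).1 a).toNat := hmono (Nat.zero_le r) a
    rw [exec_period_smul hN k (hd _)] at h2
    have h4 := congrFun (congrArg Prod.fst h2) a
    simp only at h4
    have h5 := hnonneg (g 0)
    have h6 := hnonneg (g r)
    omega

/-- The restriction of a vector to a set of letters. -/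
def restrict (W : N.Letter → Prop) (n : N.Letter → ℕ) : N.Letter → ℕ :=
  fun a => if W a then n a else 0

/-- Completing `p` to full periods can only increase the output, and there production is given by
`blockOut`. -/
theorem outVec_eq_zero (hN : N.LocallyIrreducible) {W : N.Letter → Prop}
    (hW : ∀ a b, W a → ¬ W b → N.blockOut a b = 0) {p : N.Letter → ℕ} (hp : ∀ a, W a → p a = 0)
    {q : N.State} (hq : q ∈ N.Loc) {a : N.Letter} (ha : W a) : N.outVec p q a = 0 := by
  have h1 : p ≤ N.period • p := fun b => Nat.le_mul_of_pos_left _ N.period_pos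
  have h2 : N.outVec p q a ≤ N.outVec (N.period • p) q a := N.outVec_mono h1 q a
  rw [outVec_period_smul hN p hq, Finset.sum_eq_zero fun b _ => ?_] at h2
  · omega
  · by_cases hb : W b
    · rw [hp b hb, mul_zero]
    · rw [hW a b ha hb, zero_mul]

/-- If the letters in `W` are produced by letters in `W` only, then a legal execution stays legal
when the other letters are left out. -/
theorem Legal.restrict (hN : N.LocallyIrreducible) {W : N.Letter → Prop}
    (hW : ∀ a b, W a → ¬ W b → N.blockOut a b = 0) {n p : N.Letter → ℕ} {c : N.Config}
    (hc : c.2 ∈ N.Loc) (hp : ∀ a, W a → p a = 0) (h : N.Legal n (N.exec p c)) :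
    N.Legal (restrict W n) c := by
  generalize hc' : N.exec p c = c' at h
  induction h generalizing c p with
  | zero c' =>
    have h0 : AbelianNetwork.restrict (N := N) W 0 = 0 := by
      funext a
      simp [AbelianNetwork.restrict]
    rw [h0]
    exact .zero c
  | step b n c' hb hn ih =>
    by_cases hWb : W b
    · have h1 : AbelianNetwork.restrict W (wordVec [b] + n) =
          wordVec [b] + AbelianNetwork.restrict W n := by
        funext a
        by_cases ha : W a
        · simp only [AbelianNetwork.restrict, if_pos ha, Pi.add_apply]
        · have hba : b ≠ a := fun h => ha (h ▸ hWb)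
          simp only [AbelianNetwork.restrict, if_neg ha, Pi.add_apply,
            wordVec_singleton_of_ne hba]
      rw [h1]
      refine .step b _ c ?_ (ih (c := N.confStep b c) (p := p) ?_ hp ?_)
      · rw [← hc'] at hb
        simp only [exec, outVec_eq_zero hN hW hp hc hWb, hp b hWb] at hb
        simpa using hb
      · rw [← exec_singleton]
        exact exec_mem_Loc hc _
      · rw [← exec_singleton, exec_comm, hc', exec_singleton]
    · have h1 : AbelianNetwork.restrict W (wordVec [b] + n) = AbelianNetwork.restrict W n := by
        funext a
        by_cases ha : W a
        · have hba : b ≠ a := fun h => hWb (h ▸ ha)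
          simp only [AbelianNetwork.restrict, if_pos ha, Pi.add_apply,
            wordVec_singleton_of_ne hba, zero_add]
        · simp only [AbelianNetwork.restrict, if_neg ha]
      rw [h1]
      -- Omitted letters accumulate in `p`; the induction compares with the configuration from which
      -- `p` has not been executed.
      refine ih (c := c) (p := p + wordVec [b]) hc (fun a ha => ?_) ?_
      · have hba : b ≠ a := fun h => hWb (h ▸ ha)
        rw [Pi.add_apply, hp a ha, wordVec_singleton_of_ne hba]
      · rw [exec_add, hc', exec_singleton]

/-- Restricted to `W` the loop is still legal. It restores the state and does not lower the inputs
in `W`, so it can be repeated forever. -/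
theorem unbounded_of_loop (hN : N.LocallyIrreducible) {W : N.Letter → Prop}
    (hW : ∀ a b, W a → ¬ W b → N.blockOut a b = 0) {k : N.Letter → ℕ} {c : N.Config}
    (hc : c.2 ∈ N.Loc) (h : N.Legal (N.period • k) c)
    (hk : ∀ a, W a → N.period * k a ≤ ∑ b, N.blockOut a b * k b) {a : N.Letter} (ha : W a)
    (hka : 0 < k a) : Unbounded c a := by
  have h1 : restrict W (N.period • k) = N.period • restrict W k := by
    funext a
    simp only [restrict, Pi.smul_apply, smul_eq_mul]
    split_ifs <;> simp
  have hl : N.Legal (N.period • restrict W k) c := by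
    rw [← h1]
    exact Legal.restrict hN hW (p := 0) hc (fun _ _ => rfl) (by rwa [exec_zero])
  have key : ∀ (r : ℕ) (c : N.Config), c.2 ∈ N.Loc → N.Legal (N.period • restrict W k) c →
      N.Legal (r • (N.period • restrict W k)) c := by
    intro r
    induction r with
    | zero =>
      intro c _ _
      rw [zero_smul]
      exact .zero c
    | succ r ih =>
      intro c hc hl
      rw [succ_nsmul']
      refine hl.add (ih _ (exec_mem_Loc hc _) (hl.of_le ?_ fun b hb => ?_))
      · rw [exec_period_smul hN _ hc]
      · have hWb : W b := by
          by_contra hWb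
          simp [restrict, if_neg hWb] at hb
        rw [exec_period_smul hN _ hc]
        have h2 : ∑ d, N.blockOut b d * restrict W k d = ∑ d, N.blockOut b d * k d := by
          refine Finset.sum_congr rfl fun d _ => ?_
          by_cases hd : W d
          · simp only [restrict, if_pos hd]
          · rw [hW b d hWb hd, zero_mul, zero_mul]
        have h3 := hk b hWb
        simp only [h2]
        simp only [restrict, if_pos hWb]
        omega
  intro r
  refine ⟨_, key r c hc hl, ?_⟩
  simp only [Pi.smul_apply, smul_eq_mul, restrict, if_pos ha]
  exact Nat.le_mul_of_pos_right _ (Nat.mul_pos N.period_pos hka)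

/-- Letters that can be processed arbitrarily often somewhere can be so in every recurrent
component. -/
theorem IsPast.unbounded (hN : N.LocallyIrreducible) {c : N.Config} (hc : c.2 ∈ N.Loc)
    {d : ℕ → N.Config} {n : ℕ → N.Letter → ℕ} (h : IsPast d n) (hd : ∀ i, (d i).2 ∈ N.Loc)
    (hn : ∀ a, ¬ Unbounded (d 0) a → {i | 0 < n i a}.Infinite) {a : N.Letter}
    (ha : Unbounded c a) : Unbounded (d 0) a := by
  by_contra had
  obtain ⟨l, hl, hle⟩ := exists_le_blockOut hN hc
  obtain ⟨j, k, hleg, hk⟩ := h.exists_loop hN hd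
  set G : Finset N.Letter := Finset.univ.filter fun a => Unbounded c a ∧ ¬ Unbounded (d 0) a
    with hG
  have hmem : ∀ b, b ∈ G ↔ Unbounded c b ∧ ¬ Unbounded (d 0) b := fun b => by simp [hG]
  -- Suppose some letters are unbounded at `c` but not at `d 0`. Among them minimise the ratio of
  -- the non-growing vector `k` to the sustained vector `l`.
  obtain ⟨a₀, ha₀, hmin⟩ := G.exists_min_image (fun b => (k b : ℚ) / l b)
    ⟨a, (hmem a).2 ⟨ha, had⟩⟩
  obtain ⟨hca₀, hda₀⟩ := (hmem a₀).1 ha₀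
  have hl₀ : 0 < l a₀ := (hl a₀).2 hca₀
  have hcross : ∀ b ∈ G, k a₀ * l b ≤ l a₀ * k b := fun b hb => by
    have h1 := hmin b hb
    have h2 : 0 < l b := (hl b).2 ((hmem b).1 hb).1
    rw [div_le_div_iff₀ (by exact_mod_cast hl₀) (by exact_mod_cast h2)] at h1
    rw [mul_comm (l a₀)]
    exact_mod_cast h1
  have hzero : ∀ a b, ¬ Unbounded (d 0) a → Unbounded (d 0) b → N.blockOut a b = 0 :=
    fun a b ha hb => by
      by_contra h0
      exact ha (hb.of_blockOut_pos hN (hd 0) (Nat.pos_of_ne_zero h0))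
  have hterm : ∀ a, ¬ Unbounded (d 0) a → ∀ b ∈ Finset.univ,
      k a₀ * (N.blockOut a b * l b) ≤ l a₀ * (N.blockOut a b * k b) := fun a ha b _ => by
    by_cases hb : Unbounded (d 0) b
    · rw [hzero a b ha hb]
      simp
    · rw [mul_left_comm, mul_left_comm (l a₀)]
      refine Nat.mul_le_mul_left _ ?_
      by_cases hb' : Unbounded c b
      · exact hcross b ((hmem b).2 ⟨hb', hb⟩)
      · rw [Nat.eq_zero_of_not_pos fun h => hb' ((hl b).1 h), mul_zero]
        exact Nat.zero_le _
  -- At a minimiser `a`, writing `B` for `blockOut` and `p` for the period, `k a₀ * p * l a ≤ k a₀ *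
  -- (B l) a ≤ l a₀ * (B k) a ≤ l a₀ * p * k a`, and the two ends agree. So equality holds
  -- throughout, and in each summand of the middle inequality.
  set W : N.Letter → Prop := fun b => b ∈ G ∧ k a₀ * l b = l a₀ * k b with hWdef
  have heq : ∀ a, W a → (∑ b, k a₀ * (N.blockOut a b * l b) =
      ∑ b, l a₀ * (N.blockOut a b * k b)) ∧ N.period * k a ≤ ∑ b, N.blockOut a b * k b := by
    rintro a ⟨haG, hae⟩
    have had := ((hmem a).1 haG).2
    have h1 := Finset.sum_le_sum (hterm a had)
    rw [← Finset.mul_sum, ← Finset.mul_sum] at h1 ⊢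
    have h2 := Nat.mul_le_mul_left (k a₀) (hle a)
    have h3 := Nat.mul_le_mul_left (l a₀) (hk a (hn a had)).2
    have h4 : k a₀ * (N.period * l a) = l a₀ * (N.period * k a) := by
      rw [mul_left_comm, hae, mul_left_comm]
    have h5 : l a₀ * (N.period * k a) ≤ l a₀ * ∑ b, N.blockOut a b * k b := by omega
    exact ⟨by omega, Nat.le_of_mul_le_mul_left h5 hl₀⟩
  -- If `b` produces `a`, then `b` is not unbounded at `d 0`, so `k b > 0`; the termwise equality
  -- then excludes `l b = 0` and makes `b` a minimiser too.
  have hW : ∀ a b, W a → ¬ W b → N.blockOut a b = 0 := by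
    intro a b ha hb
    have had := ((hmem a).1 ha.1).2
    have h1 := (Finset.sum_eq_sum_iff_of_le (hterm a had)).1 (heq a ha).1 b (Finset.mem_univ b)
    by_contra h0
    rw [mul_left_comm, mul_left_comm (l a₀), mul_right_inj' h0] at h1
    have hdb : ¬ Unbounded (d 0) b := fun hdb => h0 (hzero a b had hdb)
    by_cases hcb : Unbounded c b
    · exact hb ⟨(hmem b).2 ⟨hcb, hdb⟩, h1⟩
    · rw [Nat.eq_zero_of_not_pos fun h => hcb ((hl b).1 h), mul_zero] at h1
      exact (Nat.mul_pos hl₀ (hk b (hn b hdb)).1).ne h1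
  -- The minimisers are fed only by themselves and sustain themselves, so `a₀` is unbounded in the
  -- component of `d 0`, a contradiction.
  have hu := unbounded_of_loop hN hW (hd j) hleg (fun b hb => (heq b hb).2)
    (a := a₀) ⟨ha₀, mul_comm _ _⟩ (hk a₀ (hn a₀ hda₀)).1
  exact hda₀ ((unbounded_congr (h.component_eq j) a₀).1 hu)

/-- A long enough stretch of the past contains `m`; reorder it so that `m` comes last. -/
theorem IsPast.exists_undo {d : ℕ → N.Config} {n : ℕ → N.Letter → ℕ} (h : IsPast d n)
    (hd : ∀ i, (d i).2 ∈ N.Loc) {m : N.Letter → ℕ}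
    (hm : ∀ a, 0 < m a → {i | 0 < n i a}.Infinite) :
    ∃ c : N.Config, c.2 ∈ N.Loc ∧ N.exec m c = d 0 ∧ N.component c = N.component (d 0) := by
  obtain ⟨j, hj⟩ := exists_le_sum_range_of_forall_infinite (f := n) m
  obtain ⟨h1, h2⟩ := h.sum 0 j
  simp only [zero_add] at h1 h2
  obtain ⟨l, h3, h4⟩ := h1.exists_undo (n := m) fun a => by
    change m a ≤ _
    rw [Finset.sum_apply]
    rcases Nat.eq_zero_or_pos (m a) with h0 | h0
    · rw [h0]
      exact Nat.zero_le _
    · exact hj a (hm a h0)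
  exact ⟨_, exec_mem_Loc (hd j) l, h3.trans h2, by rw [h4, h2]⟩

/-- Weakly related configurations in recurrent components belong to the same component. -/
theorem component_eq_of_weaklyRelated (hN : N.LocallyIrreducible) {c c' : N.Config}
    (hc : N.IsRecurrent (N.component c)) (hc' : N.IsRecurrent (N.component c'))
    (h : WeaklyRelated c c') : N.component c = N.component c' := by
  obtain ⟨d, n, hp, hd, hdc, hn⟩ := hc.exists_past
  obtain ⟨d', n', hp', hd', hdc', hn'⟩ := hc'.exists_past
  obtain ⟨m, m', hm⟩ := ((weaklyRelated_of_component_eq hdc).trans h).trans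
    (weaklyRelated_of_component_eq hdc'.symm)
  have hU : ∀ a, Unbounded (d' 0) a ↔ Unbounded (d 0) a := fun a =>
    ⟨fun ha => hp.unbounded hN (hd' 0) hd hn ha, fun ha => hp'.unbounded hN (hd 0) hd' hn' ha⟩
  set U : N.Letter → Prop := Unbounded (d 0) with hUdef
  have hsplit : ∀ l : N.Letter → ℕ, l = restrict U l + restrict (fun a => ¬ U a) l := by
    intro l
    funext a
    by_cases ha : U a <;> simp [restrict, ha]
  have hpos : ∀ (W : N.Letter → Prop) (l : N.Letter → ℕ) a, 0 < restrict W l a → W a := by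
    intro W l a ha
    by_contra hW
    simp [restrict, hW] at ha
  -- The bounded part is undone crosswise: that of `m'` before `d 0` and that of `m` before `d' 0`.
  -- Both sides then contain the same bounded part, which `exec_injOn` cancels.
  obtain ⟨e, heL, he, hec⟩ := hp.exists_undo hd (m := restrict (fun a => ¬ U a) m')
    fun a ha => hn a (hpos _ _ a ha)
  obtain ⟨e', heL', he', hec'⟩ := hp'.exists_undo hd' (m := restrict (fun a => ¬ U a) m)
    fun a ha => hn' a fun h => hpos _ _ a ha ((hU a).1 h)
  have hf : N.component (N.exec (restrict U m) e) = N.component e :=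
    component_exec_of_unbounded fun a ha => (unbounded_congr hec a).2 (hpos _ _ a ha)
  have hf' : N.component (N.exec (restrict U m') e') = N.component e' :=
    component_exec_of_unbounded fun a ha =>
      (unbounded_congr hec' a).2 ((hU a).2 (hpos _ _ a ha))
  have hkey : N.exec (restrict U m) e = N.exec (restrict U m') e' := by
    refine exec_injOn (exec_mem_Loc heL _) (exec_mem_Loc heL' _)
      (n := restrict (fun a => ¬ U a) m + restrict (fun a => ¬ U a) m') ?_
    rw [← exec_add, ← exec_add, ← add_assoc, ← hsplit, add_comm, exec_add, he, hm, ← he',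
      ← exec_add]
    congr 1
    rw [add_left_comm, ← hsplit]
  rw [← hdc, ← hdc', ← hec, ← hec', ← hf, ← hf', hkey]

end Weak

end AbelianNetwork

theorem finite_torsion_of_fg (G : Type*) [CommGroup G] [Group.FG G] :
    Finite (CommGroup.torsion G) := by
  have : Module.Finite ℤ (Additive G) := Module.Finite.iff_addGroup_fg.2 inferInstance
  have hfin : Finite (Submodule.torsion ℤ (Additive G)) :=
    Module.finite_of_fg_torsion _ Submodule.torsion_isTorsion
  have hmem : ∀ x : CommGroup.torsion G, Additive.ofMul (x : G) ∈
      Submodule.torsion ℤ (Additive G) := by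
    rintro ⟨x, hx⟩
    obtain ⟨n, hn, h⟩ := isOfFinOrder_iff_pow_eq_one.1 hx
    refine (Submodule.mem_torsion_iff _).2
      ⟨⟨(n : ℤ), mem_nonZeroDivisors_of_ne_zero (by exact_mod_cast hn.ne')⟩, ?_⟩
    change (n : ℤ) • Additive.ofMul x = 0
    rw [natCast_zsmul, ← ofMul_pow, h, ofMul_one]
  refine Finite.of_injective (fun x : CommGroup.torsion G =>
    (⟨Additive.ofMul (x : G), hmem x⟩ : Submodule.torsion ℤ (Additive G))) fun x y h => ?_
  have h1 : Additive.ofMul (x : G) = Additive.ofMul (y : G) := by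
    simpa only [Subtype.mk.injEq] using h
  exact Subtype.ext (Additive.ofMul.injective h1)

namespace AbelianNetwork

/-! ### The shift action, the Grothendieck group and the torsion action -/

section Shift

variable {V : Type u} [Quiver.{v} V] {N : AbelianNetwork.{u, v, w, x} V} [Fintype V]
  [∀ v, Fintype (N.Alph v)] [∀ v, Finite (N.St v)] [∀ u v : V, Fintype (u ⟶ v)]

theorem exec_addInput (m n : N.Letter → ℕ) (c : N.Config) :
    N.exec m (N.addInput n c) = N.addInput n (N.exec m c) := by
  refine Prod.ext ?_ rfl
  funext b
  simp only [exec, addInput]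
  ring

theorem addInput_injective (n : N.Letter → ℕ) : Function.Injective (N.addInput n) := by
  intro c c' h
  obtain ⟨h1, h2⟩ := Prod.ext_iff.1 h
  refine Prod.ext (funext fun b => ?_) h2
  have := congrFun h1 b
  simpa only [addInput, add_left_inj] using this

theorem Lrec.exists_config (C : N.Lrec) : ∃ c : N.Config, c.2 ∈ N.Loc ∧ N.component c = C.1 := by
  obtain ⟨d, -, -, hd, hC, -⟩ := C.2.exists_past
  exact ⟨d 0, hd 0, hC⟩

theorem shift_coe (n : N.Letter → ℕ) {C : N.Lrec} {c : N.Config} (hc : N.component c = C.1) :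
    (N.shift n C).1 = N.component (N.addInput n c) := by
  rw [← shiftComponent_component, hc]
  rfl

/-- Input vectors act injectively on the recurrent components. -/
theorem shift_injective (hN : N.LocallyIrreducible) (n : N.Letter → ℕ) :
    Function.Injective (N.shift n) := by
  intro C C' h
  obtain ⟨c, -, hc⟩ := C.exists_config
  obtain ⟨c', -, hc'⟩ := C'.exists_config
  have h1 : N.component (N.addInput n c) = N.component (N.addInput n c') := by
    rw [← shift_coe n hc, ← shift_coe n hc', h]
  obtain ⟨m, m', h2⟩ := weaklyRelated_of_component_eq h1
  rw [exec_addInput, exec_addInput] at h2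
  refine Subtype.ext ?_
  rw [← hc, ← hc']
  exact component_eq_of_weaklyRelated hN (hc ▸ C.2) (hc' ▸ C'.2)
    ⟨m, m', addInput_injective n h2⟩

theorem shift_add (m n : N.Letter → ℕ) (C : N.Lrec) :
    N.shift (m + n) C = N.shift m (N.shift n C) :=
  congrFun (N.phi.map_mul (Multiplicative.ofAdd m) (Multiplicative.ofAdd n)) C

theorem shift_comm (m n : N.Letter → ℕ) (C : N.Lrec) :
    N.shift m (N.shift n C) = N.shift n (N.shift m C) := by
  rw [← shift_add, ← shift_add, add_comm]

theorem productionMatrix_mulVec (hN : N.LocallyIrreducible) {q : N.State} (hq : q ∈ N.Loc)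
    {k : N.Letter → ℕ} (hk : (fun a => (k a : ℤ)) ∈ N.totalKernel) :
    (N.productionMatrix hN).mulVec (fun a => (k a : ℚ)) = fun b => (N.outVec k q b : ℚ) :=
  N.isProductionMatrix_productionMatrix hN q hq k hk

theorem one_sub_productionMatrix_mulVec_sub (hN : N.LocallyIrreducible) {q : N.State}
    (hq : q ∈ N.Loc) {k k' : N.Letter → ℕ} (hk : (fun a => (k a : ℤ)) ∈ N.totalKernel)
    (hk' : (fun a => (k' a : ℤ)) ∈ N.totalKernel) :
    (1 - N.productionMatrix hN).mulVec (fun a => (((k a : ℤ) - (k' a : ℤ) : ℤ) : ℚ)) =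
      fun a => (((k a : ℤ) - (k' a : ℤ) - ((N.outVec k q a : ℤ) - (N.outVec k' q a : ℤ)) : ℤ) : ℚ)
      := by
  have h1 : (fun a => (((k a : ℤ) - (k' a : ℤ) : ℤ) : ℚ)) =
      (fun a => (k a : ℚ)) - fun a => (k' a : ℚ) := by
    funext a
    push_cast
    rfl
  rw [h1, Matrix.sub_mulVec, Matrix.one_mulVec, Matrix.mulVec_sub,
    productionMatrix_mulVec hN hq hk, productionMatrix_mulVec hN hq hk']
  funext a
  simp only [Pi.sub_apply]
  push_cast
  ring

/-- Expresses `(I - P)K` without `P` and `K`, by pairs of executions from one state: precisely the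
input differences that a weak relation over that state can absorb. -/
theorem mem_imageKernel_iff (hN : N.LocallyIrreducible) {q : N.State} (hq : q ∈ N.Loc)
    (z : N.Letter → ℤ) : z ∈ N.imageKernel hN ↔ ∃ k k' : N.Letter → ℕ,
      N.tVec k q = N.tVec k' q ∧
      ∀ a, z a = (k a : ℤ) - (k' a : ℤ) - ((N.outVec k q a : ℤ) - (N.outVec k' q a : ℤ)) := by
  constructor
  · rintro ⟨l, hl, hlz⟩
    -- A multiple of the period large enough that `l + k'` is nonnegative, so that `l` becomes a
    -- difference of nonnegative kernel vectors.
    set k' : N.Letter → ℕ := N.period • fun a => (l a).natAbs with hk'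
    have hk'K := N.period_smul_mem fun a => (l a).natAbs
    have hnn : ∀ a, 0 ≤ l a + (k' a : ℤ) := fun a => by
      have h1 : (l a).natAbs ≤ k' a := Nat.le_mul_of_pos_left _ N.period_pos
      omega
    have hkK : (fun a => (((l a + (k' a : ℤ)).toNat : ℕ) : ℤ)) ∈ N.totalKernel := by
      have h1 := N.totalKernel.add_mem hl hk'K
      convert h1 using 1
      funext a
      exact Int.toNat_of_nonneg (hnn a)
    refine ⟨fun a => (l a + (k' a : ℤ)).toNat, k', ?_, fun a => ?_⟩
    · rw [(N.mem_totalKernel_iff _).1 hkK q hq, (N.mem_totalKernel_iff _).1 hk'K q hq]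
    · have h1 := one_sub_productionMatrix_mulVec_sub hN hq hkK hk'K
      have h2 : (fun a => (((((l a + (k' a : ℤ)).toNat : ℕ) : ℤ) - (k' a : ℤ) : ℤ) : ℚ)) =
          fun a => (l a : ℚ) := by
        funext a
        rw [Int.toNat_of_nonneg (hnn a), add_sub_cancel_right]
      rw [h2, hlz] at h1
      exact_mod_cast congrFun h1 a
  · rintro ⟨k, k', hkk', hz⟩
    have hK : (fun a => (k a : ℤ) - (k' a : ℤ)) ∈ N.totalKernel := by
      intro q' hq'
      -- Agreement at the single state `q` spreads to all locally recurrent states by irreducibility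
      -- and commutativity.
      obtain ⟨m, rfl⟩ := N.exists_tVec_eq hN q q' hq'
      refine (N.tVec_eq_iff_of_sub_eq (m := k) (n := k') ?_ hq').1 ?_
      · funext a
        simp only [Pi.add_apply, posPart_def, negPart_def]
        omega
      · rw [N.tVec_comm k, N.tVec_comm k', hkk']
    -- Completes `k` to full periods, putting `k + r` and `k' + r` in the kernel. Since `k` and `k'`
    -- lead to the same state, the output of `r` cancels.
    set r : N.Letter → ℕ := (N.period - 1) • k with hr
    have hkr : k + r = N.period • k := by
      rw [hr, ← succ_nsmul', Nat.sub_add_cancel N.period_pos]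
    have hk1 : (fun a => ((k + r) a : ℤ)) ∈ N.totalKernel := by
      rw [hkr]
      exact N.period_smul_mem k
    have hk2 : (fun a => ((k' + r) a : ℤ)) ∈ N.totalKernel := by
      have h1 := N.totalKernel.sub_mem hk1 hK
      convert h1 using 1
      funext a
      simp only [Pi.add_apply, Pi.sub_apply]
      push_cast
      ring
    refine ⟨_, hK, ?_⟩
    have h1 := one_sub_productionMatrix_mulVec_sub hN hq hk1 hk2
    convert h1 using 1
    · congr 1
      funext a
      simp only [Pi.add_apply]
      push_cast
      ring
    · funext a
      rw [hz a, outVec_add, outVec_add, hkk']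
      simp only [Pi.add_apply]
      push_cast
      ring

/-- Two input vectors act equally on a recurrent component if and only if their difference lies in
`(I - P)K`. -/
theorem shift_eq_shift_iff (hN : N.LocallyIrreducible) (C : N.Lrec) (n n' : N.Letter → ℕ) :
    N.shift n C = N.shift n' C ↔ (fun a => (n a : ℤ) - (n' a : ℤ)) ∈ N.imageKernel hN := by
  obtain ⟨c, hcL, hc⟩ := C.exists_config
  rw [mem_imageKernel_iff hN hcL]
  constructor
  · intro h
    have h1 : N.component (N.addInput n c) = N.component (N.addInput n' c) := by
      rw [← shift_coe n hc, ← shift_coe n' hc, h]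
    obtain ⟨m, m', h2⟩ := weaklyRelated_of_component_eq h1
    refine ⟨m, m', congrArg Prod.snd h2, fun a => ?_⟩
    have h3 := congrFun (congrArg Prod.fst h2) a
    simp only [exec, addInput] at h3
    omega
  · rintro ⟨k, k', hk, hz⟩
    refine Subtype.ext ?_
    have h1 := (N.shift n C).2
    have h2 := (N.shift n' C).2
    rw [shift_coe n hc] at h1 ⊢
    rw [shift_coe n' hc] at h2 ⊢
    refine component_eq_of_weaklyRelated hN h1 h2 ⟨k, k', Prod.ext (funext fun a => ?_) hk⟩
    have h3 := hz a
    simp only [exec, addInput]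
    omega

/-! ### The Grothendieck group -/

theorem shiftElt_add (m n : N.Letter → ℕ) :
    N.shiftElt (m + n) = N.shiftElt m * N.shiftElt n :=
  Subtype.ext (N.phi.map_mul (Multiplicative.ofAdd m) (Multiplicative.ofAdd n))

theorem exists_shiftElt (s : N.ShiftMonoid) : ∃ n, N.shiftElt n = s := by
  obtain ⟨_, n, rfl⟩ := s
  exact ⟨n.toAdd, rfl⟩

/-- The criterion for equal action does not depend on the component, so one component decides;
without a recurrent component the shift monoid would be trivial. -/
theorem shiftElt_eq_iff [Nonempty N.Letter] (hN : N.LocallyIrreducible) (n n' : N.Letter → ℕ) :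
    N.shiftElt n = N.shiftElt n' ↔ (fun a => (n a : ℤ) - (n' a : ℤ)) ∈ N.imageKernel hN := by
  constructor
  · intro h
    obtain ⟨C⟩ := nonempty_Lrec hN
    exact (shift_eq_shift_iff hN C n n').1 (congrFun (congrArg Subtype.val h) C)
  · intro h
    exact Subtype.ext (funext fun C => (shift_eq_shift_iff hN C n n').2 h)

/-- The class of an input vector in `ℤ^A / (I - P)K`. -/
def inputClass (hN : N.LocallyIrreducible) (n : N.Letter → ℕ) :
    Multiplicative ((N.Letter → ℤ) ⧸ N.imageKernel hN) :=
  Multiplicative.ofAdd (QuotientAddGroup.mk fun a => (n a : ℤ))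

theorem inputClass_add (hN : N.LocallyIrreducible) (m n : N.Letter → ℕ) :
    inputClass hN (m + n) = inputClass hN m * inputClass hN n := by
  have h : (fun a => ((m + n) a : ℤ)) = (fun a => (m a : ℤ)) + fun a => (n a : ℤ) := by
    funext a
    simp
  rw [inputClass, h]
  rfl

theorem inputClass_eq_iff (hN : N.LocallyIrreducible) (n n' : N.Letter → ℕ) :
    inputClass hN n = inputClass hN n' ↔
      (fun a => (n a : ℤ) - (n' a : ℤ)) ∈ N.imageKernel hN := by
  rw [inputClass, inputClass, Multiplicative.ofAdd.apply_eq_iff_eq, eq_comm,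
    QuotientAddGroup.eq]
  have h : (-(fun a => (n' a : ℤ)) + fun a => (n a : ℤ)) =
      fun a => (n a : ℤ) - (n' a : ℤ) := by
    funext a
    simp only [Pi.add_apply, Pi.neg_apply]
    ring
  rw [h]

theorem inputClass_shiftElt_congr [Nonempty N.Letter] (hN : N.LocallyIrreducible)
    {n n' : N.Letter → ℕ} (h : N.shiftElt n = N.shiftElt n') :
    inputClass hN n = inputClass hN n' :=
  (inputClass_eq_iff hN n n').2 ((shiftElt_eq_iff hN n n').1 h)

/-- The homomorphism from the shift monoid to `ℤ^A / (I - P)K`. -/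
def shiftMonoidHom [Nonempty N.Letter] (hN : N.LocallyIrreducible) :
    N.ShiftMonoid →* Multiplicative ((N.Letter → ℤ) ⧸ N.imageKernel hN) where
  toFun s := inputClass hN (exists_shiftElt s).choose
  map_one' := by
    have h1 : N.shiftElt 0 = 1 := Subtype.ext N.phi.map_one
    have h2 : inputClass hN 0 = 1 := by
      have h := inputClass_add hN 0 0
      rw [add_zero] at h
      exact (mul_eq_left.1 h.symm)
    rw [← h2]
    exact inputClass_shiftElt_congr hN ((exists_shiftElt 1).choose_spec.trans h1.symm)
  map_mul' s t := by
    rw [← inputClass_add]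
    refine inputClass_shiftElt_congr hN ?_
    rw [shiftElt_add, (exists_shiftElt s).choose_spec, (exists_shiftElt t).choose_spec,
      (exists_shiftElt (s * t)).choose_spec]

theorem shiftMonoidHom_shiftElt [Nonempty N.Letter] (hN : N.LocallyIrreducible)
    (n : N.Letter → ℕ) : shiftMonoidHom hN (N.shiftElt n) = inputClass hN n :=
  inputClass_shiftElt_congr hN (exists_shiftElt (N.shiftElt n)).choose_spec

theorem grothPair_mul_of (n n' : N.Letter → ℕ) :
    N.grothPair n n' * Algebra.GrothendieckGroup.of (N.shiftElt n') =
      Algebra.GrothendieckGroup.of (N.shiftElt n) := by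
  change Localization.mk _ _ * Localization.mk _ _ = Localization.mk _ _
  rw [Localization.mk_mul, mul_one, Localization.mk_eq_mk_iff]
  refine Localization.r_of_eq ?_
  simp [mul_comm]

theorem exists_grothPair (g : N.Groth) : ∃ n n', g = N.grothPair n n' := by
  induction g using Localization.induction_on with
  | H y =>
    obtain ⟨n, hn⟩ := exists_shiftElt y.1
    obtain ⟨n', hn'⟩ := exists_shiftElt (y.2 : N.ShiftMonoid)
    refine ⟨n, n', ?_⟩
    simp only [grothPair, hn, hn']

/-- The homomorphism from the Grothendieck group to `ℤ^A / (I - P)K`. -/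
def grothHom [Nonempty N.Letter] (hN : N.LocallyIrreducible) :
    N.Groth →* Multiplicative ((N.Letter → ℤ) ⧸ N.imageKernel hN) :=
  Algebra.GrothendieckGroup.lift (shiftMonoidHom hN)

theorem grothHom_of [Nonempty N.Letter] (hN : N.LocallyIrreducible) (n : N.Letter → ℕ) :
    grothHom hN (Algebra.GrothendieckGroup.of (N.shiftElt n)) = inputClass hN n := by
  rw [← shiftMonoidHom_shiftElt]
  exact DFunLike.congr_fun (Algebra.GrothendieckGroup.lift.left_inv (shiftMonoidHom hN)) _

theorem grothHom_grothPair [Nonempty N.Letter] (hN : N.LocallyIrreducible)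
    (n n' : N.Letter → ℕ) :
    grothHom hN (N.grothPair n n') = inputClass hN n / inputClass hN n' := by
  rw [eq_div_iff_mul_eq', ← grothHom_of, ← grothHom_of, ← map_mul, grothPair_mul_of]

theorem grothHom_bijective [Nonempty N.Letter] (hN : N.LocallyIrreducible) :
    Function.Bijective (grothHom hN) := by
  constructor
  · rw [injective_iff_map_eq_one]
    intro g hg
    obtain ⟨n, n', rfl⟩ := exists_grothPair g
    rw [grothHom_grothPair, div_eq_one, inputClass_eq_iff, ← shiftElt_eq_iff] at hg
    have h := grothPair_mul_of (N := N) n n'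
    rw [hg] at h
    exact mul_eq_right.1 h
  · intro z
    obtain ⟨z, rfl⟩ := Multiplicative.ofAdd.surjective z
    obtain ⟨z, rfl⟩ := QuotientAddGroup.mk_surjective z
    refine ⟨N.grothPair (fun a => (z a).toNat) (fun a => (-z a).toNat), ?_⟩
    rw [grothHom_grothPair, div_eq_iff_eq_mul]
    change Multiplicative.ofAdd _ = Multiplicative.ofAdd _ * Multiplicative.ofAdd _
    rw [← ofAdd_add, ← QuotientAddGroup.mk_add]
    congr 2
    funext a
    simp only [Pi.add_apply]
    omega

theorem grothPair_eq_iff [Nonempty N.Letter] (hN : N.LocallyIrreducible)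
    (n n' l l' : N.Letter → ℕ) : N.grothPair n n' = N.grothPair l l' ↔
      (fun a => ((n + l') a : ℤ) - ((l + n') a : ℤ)) ∈ N.imageKernel hN := by
  rw [← (grothHom_bijective hN).1.eq_iff, grothHom_grothPair, grothHom_grothPair,
    div_eq_div_iff_mul_eq_mul, ← inputClass_add, ← inputClass_add, inputClass_eq_iff]

/-- Equality in the Grothendieck group can be tested on any single recurrent component; this yields
both well-definedness and freeness of the torsion action. -/
theorem grothPair_eq_iff_shift [Nonempty N.Letter] (hN : N.LocallyIrreducible)
    (n n' l l' : N.Letter → ℕ) (C : N.Lrec) : N.grothPair n n' = N.grothPair l l' ↔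
      N.shift (n + l') C = N.shift (l + n') C := by
  rw [grothPair_eq_iff hN, shift_eq_shift_iff hN]

theorem grothPair_mul (n n' l l' : N.Letter → ℕ) :
    N.grothPair n n' * N.grothPair l l' = N.grothPair (n + l) (n' + l') := by
  simp only [grothPair, Localization.mk_mul, shiftElt_add]
  rfl

theorem grothPair_self (n : N.Letter → ℕ) : N.grothPair n n = 1 :=
  mul_eq_right.1 (grothPair_mul_of n n)

theorem finite_Tor [Nonempty N.Letter] (hN : N.LocallyIrreducible) : Finite N.Tor := by
  have h1 : AddGroup.FG (N.Letter → ℤ) := Module.Finite.iff_addGroup_fg.1 inferInstance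
  have h2 : AddGroup.FG ((N.Letter → ℤ) ⧸ N.imageKernel hN) := inferInstance
  have h3 : Group.FG N.Groth :=
    Group.fg_of_surjective
      (f := (MulEquiv.ofBijective _ (grothHom_bijective hN)).symm.toMonoidHom)
      (MulEquiv.surjective _)
  exact finite_torsion_of_fg N.Groth

/-! ### The action of the torsion group -/

/-- Fix a fraction `[l g, l' g]` for each of the finitely many torsion elements and shift any
recurrent component by the sum of all `l' g`. Then `g` acts by replacing the summand `l' g` with `l
g`. -/
theorem nonempty_LrecInv [Nonempty N.Letter] (hN : N.LocallyIrreducible) :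
    Nonempty N.LrecInv := by
  obtain ⟨C⟩ := nonempty_Lrec hN
  have := finite_Tor hN
  have := Fintype.ofFinite N.Tor
  choose l l' hl using fun g : N.Tor => exists_grothPair (g : N.Groth)
  refine ⟨⟨N.shift (∑ g, l' g) C, fun g hg n n' hn => ?_⟩⟩
  have hle : l' ⟨g, hg⟩ ≤ ∑ g, l' g :=
    Finset.single_le_sum (fun _ _ => zero_le) (Finset.mem_univ _)
  obtain ⟨r, hr⟩ := exists_add_of_le hle
  refine ⟨N.shift (r + l ⟨g, hg⟩) C, ?_⟩
  have h1 := (grothPair_eq_iff_shift hN n n' (l ⟨g, hg⟩) (l' ⟨g, hg⟩) (N.shift r C)).1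
    (hn.symm.trans (hl ⟨g, hg⟩))
  rw [← shift_add, ← shift_add] at h1 ⊢
  rw [hr]
  convert h1 using 2 <;> abel

/-- The result of letting an element of the torsion group act on an invertible component. -/
theorem exists_smul [Nonempty N.Letter] (hN : N.LocallyIrreducible) (g : N.Tor)
    (C : N.LrecInv) : ∃ C' : N.Lrec, ∀ n n' : N.Letter → ℕ, (g : N.Groth) = N.grothPair n n' →
      N.shift n C.1 = N.shift n' C' := by
  obtain ⟨l, l', hl⟩ := exists_grothPair (g : N.Groth)
  obtain ⟨C', hC'⟩ := C.2 g g.2 l l' hl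
  -- The component found for one fraction serves all of them, because the denominator `l'` can be
  -- cancelled.
  refine ⟨C', fun n n' hn => shift_injective hN l' ?_⟩
  rw [shift_comm l' n' C', ← hC', ← shift_add, ← shift_add, add_comm l', add_comm n']
  exact (grothPair_eq_iff_shift hN n n' l l' C.1).1 (hn.symm.trans hl)

/-- The component obtained when an element of the torsion group acts on an invertible
component. -/
def torSmul [Nonempty N.Letter] (hN : N.LocallyIrreducible) (g : N.Tor) (C : N.LrecInv) :
    N.Lrec := (exists_smul hN g C).choose

theorem shift_eq_shift_torSmul [Nonempty N.Letter] (hN : N.LocallyIrreducible) {g : N.Tor}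
    (C : N.LrecInv) {n n' : N.Letter → ℕ} (h : (g : N.Groth) = N.grothPair n n') :
    N.shift n C.1 = N.shift n' (torSmul hN g C) :=
  (exists_smul hN g C).choose_spec n n' h

/-- The component `gC` is determined by a single representation of `g`. -/
theorem eq_torSmul_iff [Nonempty N.Letter] (hN : N.LocallyIrreducible) {g : N.Tor}
    (C : N.LrecInv) {n n' : N.Letter → ℕ} (h : (g : N.Groth) = N.grothPair n n')
    (C' : N.Lrec) : N.shift n C.1 = N.shift n' C' ↔ C' = torSmul hN g C := by
  rw [shift_eq_shift_torSmul hN C h, (shift_injective hN n').eq_iff, eq_comm]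

theorem shift_torSmul [Nonempty N.Letter] (hN : N.LocallyIrreducible) (g g' : N.Tor)
    (C : N.LrecInv) {n n' : N.Letter → ℕ} (h : (g' : N.Groth) = N.grothPair n n') :
    N.shift n (torSmul hN g C) = N.shift n' (torSmul hN (g' * g) C) := by
  obtain ⟨l, l', hl⟩ := exists_grothPair (g : N.Groth)
  have h1 : ((g' * g : N.Tor) : N.Groth) = N.grothPair (n + l) (n' + l') := by
    rw [Subgroup.coe_mul, h, hl, grothPair_mul]
  have h2 := shift_eq_shift_torSmul hN C h1
  refine shift_injective hN l' ?_
  rw [shift_comm l' n, ← shift_eq_shift_torSmul hN C hl, ← shift_add, h2, add_comm n', shift_add]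

theorem isInvertible_torSmul [Nonempty N.Letter] (hN : N.LocallyIrreducible) (g : N.Tor)
    (C : N.LrecInv) : N.IsInvertible (torSmul hN g C) :=
  fun g' hg' _ _ h => ⟨_, shift_torSmul hN g ⟨g', hg'⟩ C h⟩

/-- The action of the torsion group on the invertible recurrent components. -/
abbrev torAction [Nonempty N.Letter] (hN : N.LocallyIrreducible) : MulAction N.Tor N.LrecInv where
  smul g C := ⟨torSmul hN g C, isInvertible_torSmul hN g C⟩
  one_smul C := by
    refine Subtype.ext ((eq_torSmul_iff hN C (g := 1) (n := 0) (n' := 0) ?_ C.1).1 rfl).symm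
    rw [grothPair_self]
    rfl
  mul_smul g' g C := by
    obtain ⟨n, n', h⟩ := exists_grothPair (g' : N.Groth)
    exact Subtype.ext ((eq_torSmul_iff hN ⟨torSmul hN g C, isInvertible_torSmul hN g C⟩ h _).1
      (shift_torSmul hN g g' C h))

theorem torSmul_injective [Nonempty N.Letter] (hN : N.LocallyIrreducible) {g g' : N.Tor}
    {C : N.LrecInv} (h : torSmul hN g C = torSmul hN g' C) : g = g' := by
  obtain ⟨n, n', hn⟩ := exists_grothPair (g : N.Groth)
  obtain ⟨l, l', hl⟩ := exists_grothPair (g' : N.Groth)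
  refine Subtype.ext ?_
  rw [hn, hl, grothPair_eq_iff_shift hN n n' l l' C.1, add_comm n, add_comm l, shift_add,
    shift_add, shift_eq_shift_torSmul hN C hn, shift_eq_shift_torSmul hN C hl, h, shift_comm]

end Shift

end AbelianNetwork

end

theorem mainTheorem1 {V : Type u} [Quiver.{v} V] [Fintype V] [∀ v₁ v₂ : V, Fintype (v₁ ⟶ v₂)]
    (N : AbelianNetwork.{u, v, w, x} V) [∀ v, Fintype (N.Alph v)] [∀ v, Finite (N.St v)]
    [Nonempty N.Letter] (hN : N.LocallyIrreducible) :
    Nonempty N.LrecInv ∧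
    (Finite N.Tor ∧
      ∃ _ : MulAction N.Tor N.LrecInv,
        (∀ (g : N.Tor) (C : N.LrecInv) (n n' : N.Letter → ℕ), (g : N.Groth) = N.grothPair n n' →
          ∀ C' : N.Lrec, N.shift n C.1 = N.shift n' C' ↔ C' = (g • C).1) ∧
        (∀ (C : N.LrecInv) (g g' : N.Tor), g • C = g' • C → g = g')) ∧
    ∃ f : N.Groth ≃* Multiplicative ((N.Letter → ℤ) ⧸ N.imageKernel hN),
      ∀ n : N.Letter → ℕ, f (Algebra.GrothendieckGroup.of (N.shiftElt n)) =
        Multiplicative.ofAdd (QuotientAddGroup.mk fun a => (n a : ℤ)) := by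
  refine ⟨AbelianNetwork.nonempty_LrecInv hN, ⟨AbelianNetwork.finite_Tor hN,
    AbelianNetwork.torAction hN, fun g C n n' h C' => AbelianNetwork.eq_torSmul_iff hN C h C',
    fun C g g' h => AbelianNetwork.torSmul_injective hN (congrArg Subtype.val h)⟩,
    MulEquiv.ofBijective _ (AbelianNetwork.grothHom_bijective hN),
    fun n => AbelianNetwork.grothHom_of hN n⟩
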